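/- **Conventions.** Hilbert spaces are complex, $\mathbb{B}(\mathcal{H})$ and $\mathbb{K}(\mathcal{H})$ are the bounded and the compact operators, and $A$ is a (not necessarily unital) $C^*$-algebra. Products and commutators of unbounded operators have their maximal domains. Representations are $*$-homomorphisms $\rho\colon A\to\mathbb{B}(\mathcal{H})$, not necessarily faithful or nondegenerate. **Definition 1.** A *higher-order spectral triple* $(\mathcal{A},\mathcal{H},\mathcal{D})$ of order $m>0$ ($m$ real) for $A$ consists of a separable Hilbert space $\mathcal{H}$, a representation $\rho\colon A\to\mathbb{B}(\mathcal{H})$, a dense $*$-subalgebra $\mathcal{A}\subseteq A$ and a self-adjoint operator $\mathcal{D}$ on $\mathcal{H}$ such that for every $a\in\mathcal{A}$: (i) $\rho(a)\,\mathrm{dom}\,\mathcal{D}\subseteq\mathrm{dom}\,\mathcal{D}$; (ii) $\rho(a)(1+\mathcal{D}^2)^{-1/2}\in\mathbb{K}(\mathcal{H})$; (iii) $[\mathcal{D},\rho(a)](1+\mathcal{D}^2)^{-\frac12+\frac1{2m}}$ extends to an element of $\mathbb{B}(\mathcal{H})$. It is *even* if $\mathcal{H}$ is moreover $\mathbb{Z}/2$-graded,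 every $\rho(a)$ is even and $\mathcal{D}$ is odd. **Definition 2.** Let $J\vartriangleleft A$ be a closed two-sided ideal. A *higher-order relative spectral triple* $(\mathcal{J}\vartriangleleft\mathcal{A},\mathcal{H},\mathcal{D})$ of order $m>0$ for $J\vartriangleleft A$ consists of a separable Hilbert space $\mathcal{H}$, a representation $\rho\colon A\to\mathbb{B}(\mathcal{H})$, a dense $*$-subalgebra $\mathcal{A}\subseteq A$, a $*$-subalgebra $\mathcal{J}\subseteq J\cap\mathcal{A}$ that is dense in $J$, and a symmetric closed densely defined operator $\mathcal{D}$ on $\mathcal{H}$ such that for all $a\in\mathcal{A}$ and $j\in\mathcal{J}$: (i) $\rho(a)\,\mathrm{dom}\,\mathcal{D}\subseteq\mathrm{dom}\,\mathcal{D}$; (ii) $\rho(j)\,\mathrm{dom}\,\mathcal{D}^*\subseteq\mathrm{dom}\,\mathcal{D}$; (iii) $\rho(j)(1+\mathcal{D}^*\mathcal{D})^{-1/2}\in\mathbb{K}(\mathcal{H})$; (iv) $[\mathcal{D},\rho(a)](1+\mathcal{D}^*\mathcal{D})^{-1/2}\in\mathbb{K}(\mathcal{H})$; (v) $[\mathcal{D},\rho(a)](1+\mathcal{D}^*\mathcal{D})^{-\frac12+\frac1{2m}}$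 extends to an element of $\mathbb{B}(\mathcal{H})$. It is *even* under the same additional conditions as in Definition 1. **Theorem.** Let $(\mathcal{A},\mathcal{H},\mathcal{D})$ be a higher-order spectral triple of order $m>0$ for $A$, with representation $\rho$, and suppose that $A$ is unital or that $[\mathcal{D},\rho(a)](1+\mathcal{D}^2)^{-1/2}\in\mathbb{K}(\mathcal{H})$ for all $a\in\mathcal{A}$. Let $\mathcal{J}\subseteq\mathcal{A}$ be a two-sided $*$-ideal of $\mathcal{A}$ such that $\mathcal{D}$ is local with respect to $\mathcal{J}$: for every $j\in\mathcal{J}$ there is $k\in\mathcal{J}$ with $j=kj$ and $\mathcal{D}\rho(j)=\rho(k)\mathcal{D}\rho(j)$ on $\mathrm{dom}\,\mathcal{D}$. Put $\mathcal{H}_{\mathcal{J}}=\overline{\mathcal{J}\mathcal{H}}$ (closed linear span of the vectors $\rho(j)v$ with $j\in\mathcal{J}$, $v\in\mathcal{H}$), with the restricted representation $\rho_{\mathcal{J}}$ of $A$ (and, in the even case, the restricted grading), let $\mathcal{D}_{\mathcal{J}}=\overline{\mathcal{D}|_{\mathcal{J}\,\mathrm{dom}\,\mathcal{D}}}$ be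 the closure, as an operator on $\mathcal{H}_{\mathcal{J}}$, of the restriction of $\mathcal{D}$ to the linear span of the vectors $\rho(j)v$ with $j\in\mathcal{J}$, $v\in\mathrm{dom}\,\mathcal{D}$, and let $J=\overline{\mathcal{J}}$ be the closure of $\mathcal{J}$ in $A$. Then $(\mathcal{J}\vartriangleleft\mathcal{A},\mathcal{H}_{\mathcal{J}},\mathcal{D}_{\mathcal{J}})$ is a higher-order relative spectral triple for $J\vartriangleleft A$, of order $\max(m,1)$ (thus of the same order $m$ if $m\ge 1$), and it is even if $(\mathcal{A},\mathcal{H},\mathcal{D})$ is even. Moreover, $\rho_{\mathcal{J}}(a)(1+\mathcal{D}_{\mathcal{J}}^*\mathcal{D}_{\mathcal{J}})^{-1/2}\in\mathbb{K}(\mathcal{H}_{\mathcal{J}})$ for all $a\in\mathcal{A}$. -/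

import Mathlib

namespace RelSpectral

noncomputable section

section Unbounded

variable {H : Type*} [NormedAddCommGroup H] [InnerProductSpace ℂ H]

/-- A bounded operator, regarded as an everywhere defined unbounded operator. -/
def bdd (B : H →L[ℂ] H) : H →ₗ.[ℂ] H :=
  (B : H →ₗ[ℂ] H).toPMap ⊤

/-- The product `S T` of two unbounded operators on its maximal domain
`{x ∈ dom T | T x ∈ dom S}`. -/
def pcomp (S T : H →ₗ.[ℂ] H) : H →ₗ.[ℂ] H where
  domain :=
    { carrier := {x | ∃ h : x ∈ T.domain, T ⟨x, h⟩ ∈ S.domain}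
      zero_mem' := ⟨T.domain.zero_mem, by
        have h : T ⟨0, T.domain.zero_mem⟩ = 0 := T.map_zero
        rw [h]
        exact S.domain.zero_mem⟩
      add_mem' := by
        rintro x y ⟨hx, hx'⟩ ⟨hy, hy'⟩
        refine ⟨T.domain.add_mem hx hy, ?_⟩
        have h := T.map_add ⟨x, hx⟩ ⟨y, hy⟩
        exact h ▸ S.domain.add_mem hx' hy'
      smul_mem' := by
        rintro c x ⟨hx, hx'⟩
        refine ⟨T.domain.smul_mem c hx, ?_⟩
        have h := T.map_smul c ⟨x, hx⟩
        exact h ▸ S.domain.smul_mem c hx' }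
  toFun :=
    { toFun := fun x => S ⟨T ⟨x.1, x.2.1⟩, x.2.2⟩
      map_add' := fun x y => by
        rw [← S.map_add]
        congr 1
        exact Subtype.ext (T.map_add ⟨x.1, x.2.1⟩ ⟨y.1, y.2.1⟩)
      map_smul' := fun c x => by
        rw [RingHom.id_apply, ← S.map_smul]
        congr 1
        exact Subtype.ext (T.map_smul c ⟨x.1, x.2.1⟩) }

/-- The commutator `[D, B] = D B - B D` with domain `{x ∈ dom D | B x ∈ dom D}`. -/
def opCommutator (D : H →ₗ.[ℂ] H) (B : H →L[ℂ] H) : H →ₗ.[ℂ] H :=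
  pcomp D (bdd B) - pcomp (bdd B) D

/-- The unbounded operator `T` extends to an element of `𝔹(H)`. -/
def ExtendsToBounded (T : H →ₗ.[ℂ] H) : Prop :=
  ∃ B : H →L[ℂ] H, T ≤ bdd B

/-- `T ∈ 𝕂(H)`: the operator `T` is everywhere defined and compact. -/
def IsCompactPMap (T : H →ₗ.[ℂ] H) : Prop :=
  ∃ K : H →L[ℂ] H, IsCompactOperator K ∧ T = bdd K

/-- `D` is symmetric: `⟨D x, y⟩ = ⟨x, D y⟩` for all `x, y ∈ dom D`. -/
def IsSymmetric (D : H →ₗ.[ℂ] H) : Prop :=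
  ∀ x y : D.domain, inner ℂ (D x) (y : H) = inner ℂ (x : H) (D y)

/-- The restriction of `T` to `{x ∈ K ∩ dom T | T x ∈ K}`, regarded as an unbounded operator
on the subspace `K`. -/
def partIn (T : H →ₗ.[ℂ] H) (K : Submodule ℂ H) : K →ₗ.[ℂ] K where
  domain :=
    { carrier := {x | ∃ h : (x : H) ∈ T.domain, T ⟨x, h⟩ ∈ K}
      zero_mem' := ⟨T.domain.zero_mem, by
        have h : T (0 : T.domain) = 0 := T.map_zero
        exact h ▸ K.zero_mem⟩
      add_mem' := by
        rintro x y ⟨hx, hx'⟩ ⟨hy, hy'⟩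
        refine ⟨T.domain.add_mem hx hy, ?_⟩
        have h := T.map_add ⟨x, hx⟩ ⟨y, hy⟩
        exact h ▸ K.add_mem hx' hy'
      smul_mem' := by
        rintro c x ⟨hx, hx'⟩
        refine ⟨T.domain.smul_mem c hx, ?_⟩
        have h := T.map_smul c ⟨x, hx⟩
        exact h ▸ K.smul_mem c hx' }
  toFun :=
    { toFun := fun x => ⟨T ⟨x.1, x.2.1⟩, x.2.2⟩
      map_add' := fun x y => Subtype.ext (T.map_add ⟨x.1, x.2.1⟩ ⟨y.1, y.2.1⟩)
      map_smul' := fun c x => Subtype.ext (T.map_smul c ⟨x.1, x.2.1⟩) }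

variable [CompleteSpace H]

/-- The graph of `T` as a subspace of the Hilbert space `H ⊕ H`. -/
def graphL2 (T : H →ₗ.[ℂ] H) : Submodule ℂ (WithLp 2 (H × H)) :=
  T.graph.map ((WithLp.linearEquiv 2 ℂ (H × H)).symm : (H × H) →ₗ[ℂ] WithLp 2 (H × H))

/-- The bounded operator `(1 + T*T)⁻¹` of a closed densely defined operator `T`: the vector
`(1 + T*T)⁻¹ x` is the first component of the orthogonal projection of `(x, 0)` onto the graph
of `T`; see `oneAddInv_spec`. -/
def oneAddInv (T : H →ₗ.[ℂ] H) : H →L[ℂ] H :=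
  WithLp.fstL 2 ℂ H H ∘L (graphL2 T).topologicalClosure.starProjection ∘L
    ((WithLp.prodContinuousLinearEquiv 2 ℂ H H).symm : (H × H) →L[ℂ] WithLp 2 (H × H)) ∘L
    ContinuousLinearMap.inl ℂ H H

/-- `oneAddInv T` is the everywhere defined inverse of `1 + T*T`. -/
theorem oneAddInv_spec {T : H →ₗ.[ℂ] H} (hT : T.IsClosed) (hd : Dense (T.domain : Set H)) (x : H) :
    ∃ (h : oneAddInv T x ∈ T.domain) (h' : T ⟨oneAddInv T x, h⟩ ∈ T.adjoint.domain),
      oneAddInv T x + T.adjoint ⟨T ⟨oneAddInv T x, h⟩, h'⟩ = x := by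
  set w : WithLp 2 (H × H) := WithLp.toLp 2 (x, 0) with hw
  set p := (graphL2 T).topologicalClosure.starProjection w with hp
  have hu : oneAddInv T x = p.fst := rfl
  have hcl : IsClosed (graphL2 T : Set (WithLp 2 (H × H))) := by
    have h : (graphL2 T : Set (WithLp 2 (H × H))) =
        (WithLp.prodContinuousLinearEquiv 2 ℂ H H) ⁻¹' (T.graph : Set (H × H)) := by
      ext z
      constructor
      · rintro ⟨y, hy, rfl⟩
        exact hy
      · intro hz
        exact ⟨z.ofLp, hz, rfl⟩
    rw [h]
    exact IsClosed.preimage (WithLp.prodContinuousLinearEquiv 2 ℂ H H).continuous hT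
  have hmem : p ∈ graphL2 T := by
    have h : p ∈ (graphL2 T).topologicalClosure := Submodule.starProjection_apply_mem _ w
    rwa [hcl.submodule_topologicalClosure_eq] at h
  obtain ⟨⟨a, b⟩, hab, habp⟩ := hmem
  obtain ⟨y, hy1, hy2⟩ := T.mem_graph_iff.1 hab
  have hpa : p.fst = (y : H) := by rw [← habp]; exact hy1.symm
  have hpb : p.snd = T y := by rw [← habp]; exact hy2.symm
  have horth : ∀ v : T.domain, inner ℂ (x - (y : H)) (v : H) = inner ℂ (T y) (T v) := by
    intro v
    have hv : WithLp.toLp 2 ((v : H), T v) ∈ (graphL2 T).topologicalClosure :=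
      Submodule.le_topologicalClosure _ ⟨((v : H), T v), T.mem_graph v, rfl⟩
    have h0 := Submodule.starProjection_inner_eq_zero (K := (graphL2 T).topologicalClosure) w _ hv
    rw [← hp, WithLp.prod_inner_apply] at h0
    have h1 : (w - p).ofLp.1 = x - (y : H) := by rw [← hpa]; rfl
    have h2 : (w - p).ofLp.2 = -T y := by rw [← hpb]; exact zero_sub _
    rw [h1, h2, inner_neg_left] at h0
    exact add_neg_eq_zero.1 h0
  have hyeq : (⟨oneAddInv T x, (hu.trans hpa) ▸ y.2⟩ : T.domain) = y :=
    Subtype.ext (hu.trans hpa)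
  have hadj : T y ∈ T.adjoint.domain := T.mem_adjoint_domain_of_exists _ ⟨_, horth⟩
  refine ⟨(hu.trans hpa) ▸ y.2, by rw [hyeq]; exact hadj, ?_⟩
  have h3 : T.adjoint ⟨T y, hadj⟩ = x - (y : H) := LinearPMap.adjoint_apply_eq hd _ horth
  simp only [hyeq, h3]
  rw [hu, hpa]
  abel

/-- The power `(1 + T*T)^t` for real `t`: for `t ≤ 0` the bounded operator `((1 + T*T)⁻¹)^(-t)`
given by continuous functional calculus, for `t > 0` the (unbounded) inverse of
`(1 + T*T)^(-t)`. -/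
def oneAddPow (T : H →ₗ.[ℂ] H) (t : ℝ) : H →ₗ.[ℂ] H :=
  if t ≤ 0 then bdd (oneAddInv T ^ (-t)) else (bdd (oneAddInv T ^ t)).inverse

/-- The bounded operator `(1 + T*T)^(-1/2)`. -/
def oneAddInvSqrt (T : H →ₗ.[ℂ] H) : H →L[ℂ] H :=
  oneAddInv T ^ (1 / 2 : ℝ)

end Unbounded

section Triples

variable {A : Type*} [NonUnitalCStarAlgebra A]
  {H : Type*} [NormedAddCommGroup H] [InnerProductSpace ℂ H] [CompleteSpace H]

/-- `(𝒜, H, D)` with the representation `ρ` is a higher-order spectral triple of order `m` for `A`,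
disregarding gradings (an odd higher-order spectral triple). It is even with respect to a
grading operator `γ` if moreover `IsGrading γ ρ D` holds. -/
structure IsHigherOrderSpectralTriple (ρ : A →⋆ₙₐ[ℂ] (H →L[ℂ] H))
    (𝒜 : NonUnitalStarSubalgebra ℂ A) (D : H →ₗ.[ℂ] H) (m : ℝ) : Prop where
  order_pos : 0 < m
  separable : TopologicalSpace.SeparableSpace H
  dense_alg : Dense (𝒜 : Set A)
  dense_domain : Dense (D.domain : Set H)
  selfAdjoint : D.adjoint = D
  map_domain : ∀ a ∈ 𝒜, ∀ x ∈ D.domain, ρ a x ∈ D.domain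
  compact_resolvent : ∀ a ∈ 𝒜, IsCompactOperator (ρ a ∘L oneAddInvSqrt D)
  bounded_commutator : ∀ a ∈ 𝒜,
    ExtendsToBounded (pcomp (opCommutator D (ρ a)) (oneAddPow D (-(1 / 2) + 1 / (2 * m))))

/-- `(𝒥 ◁ 𝒜, H, D)` with the representation `ρ` is a higher-order relative spectral triple of
order `m` for `J ◁ A`, disregarding gradings (an odd one). It is even with respect to a
grading operator `γ` if moreover `IsGrading γ ρ D` holds. -/
structure IsHigherOrderRelativeSpectralTriple (ρ : A →⋆ₙₐ[ℂ] (H →L[ℂ] H))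
    (𝒜 J 𝒥 : NonUnitalStarSubalgebra ℂ A) (D : H →ₗ.[ℂ] H) (m : ℝ) : Prop where
  order_pos : 0 < m
  separable : TopologicalSpace.SeparableSpace H
  dense_alg : Dense (𝒜 : Set A)
  isClosed_ideal : IsClosed (J : Set A)
  ideal : ∀ a : A, ∀ j ∈ J, a * j ∈ J ∧ j * a ∈ J
  sub_alg : 𝒥 ≤ 𝒜
  sub_ideal : 𝒥 ≤ J
  dense_ideal : (J : Set A) ⊆ closure (𝒥 : Set A)
  dense_domain : Dense (D.domain : Set H)
  isClosed_op : D.IsClosed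
  symmetric : IsSymmetric D
  map_domain : ∀ a ∈ 𝒜, ∀ x ∈ D.domain, ρ a x ∈ D.domain
  map_adjoint_domain : ∀ j ∈ 𝒥, ∀ x ∈ D.adjoint.domain, ρ j x ∈ D.domain
  compact_resolvent : ∀ j ∈ 𝒥, IsCompactOperator (ρ j ∘L oneAddInvSqrt D)
  compact_commutator : ∀ a ∈ 𝒜,
    IsCompactPMap (pcomp (opCommutator D (ρ a)) (bdd (oneAddInvSqrt D)))
  bounded_commutator : ∀ a ∈ 𝒜,
    ExtendsToBounded (pcomp (opCommutator D (ρ a)) (oneAddPow D (-(1 / 2) + 1 / (2 * m))))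

/-- `γ` is the grading operator of a `ℤ/2`-grading on `H` (the even and odd parts are the
eigenspaces of `γ` for `1` and `-1`) for which every `ρ a` is even and `D` is odd. -/
structure IsGrading (γ : H →L[ℂ] H) (ρ : A →⋆ₙₐ[ℂ] (H →L[ℂ] H)) (D : H →ₗ.[ℂ] H) : Prop where
  selfAdjoint : IsSelfAdjoint γ
  sq : γ ∘L γ = ContinuousLinearMap.id ℂ H
  even : ∀ a, γ ∘L ρ a = ρ a ∘L γ
  odd : ∀ x : D.domain, ∃ h : γ (x : H) ∈ D.domain, D ⟨γ (x : H), h⟩ = -γ (D x)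

/-- `𝒥` is a (two-sided) `*`-ideal of `𝒜`. -/
structure IsStarIdeal (𝒥 𝒜 : NonUnitalStarSubalgebra ℂ A) : Prop where
  le : 𝒥 ≤ 𝒜
  mul_left : ∀ a ∈ 𝒜, ∀ j ∈ 𝒥, a * j ∈ 𝒥
  mul_right : ∀ a ∈ 𝒜, ∀ j ∈ 𝒥, j * a ∈ 𝒥

/-- `D` is local with respect to `𝒥`: each `j ∈ 𝒥` has a `k ∈ 𝒥` with `j = k j` and
`D j = k D j` on `dom D`. -/
def IsLocal (ρ : A →⋆ₙₐ[ℂ] (H →L[ℂ] H)) (𝒥 : NonUnitalStarSubalgebra ℂ A) (D : H →ₗ.[ℂ] H) :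
    Prop :=
  ∀ j ∈ 𝒥, ∃ k ∈ 𝒥, j = k * j ∧
    ∀ x ∈ D.domain, ∃ h : ρ j x ∈ D.domain, D ⟨ρ j x, h⟩ = ρ k (D ⟨ρ j x, h⟩)

/-- The linear span of `𝒥 W = {ρ(j) w | j ∈ 𝒥, w ∈ W}`. -/
def idealSpan (ρ : A →⋆ₙₐ[ℂ] (H →L[ℂ] H)) (𝒥 : NonUnitalStarSubalgebra ℂ A)
    (W : Submodule ℂ H) : Submodule ℂ H :=
  Submodule.span ℂ {x | ∃ j ∈ 𝒥, ∃ w ∈ W, x = ρ j w}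

/-- The Hilbert space `H_𝒥`, the closure of `𝒥 H`. -/
abbrev localSpace (ρ : A →⋆ₙₐ[ℂ] (H →L[ℂ] H)) (𝒥 : NonUnitalStarSubalgebra ℂ A) :
    Submodule ℂ H :=
  (idealSpan ρ 𝒥 ⊤).topologicalClosure

/-- The restriction of a representation to a closed invariant subspace. -/
def subrep (ρ : A →⋆ₙₐ[ℂ] (H →L[ℂ] H)) (K : Submodule ℂ H) [CompleteSpace K]
    (hK : ∀ a, ∀ x ∈ K, ρ a x ∈ K) : A →⋆ₙₐ[ℂ] (K →L[ℂ] K) where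
  toFun a := ((ρ a) ∘L K.subtypeL).codRestrict K fun x => hK a x x.2
  map_smul' c a := by
    ext x
    change ρ (c • a) (x : H) = c • ρ a (x : H)
    rw [map_smul]
    rfl
  map_zero' := by
    ext x
    change ρ 0 (x : H) = 0
    rw [map_zero]
    rfl
  map_add' a b := by
    ext x
    change ρ (a + b) (x : H) = ρ a (x : H) + ρ b (x : H)
    rw [map_add]
    rfl
  map_mul' a b := by
    ext x
    change ρ (a * b) (x : H) = ρ a (ρ b (x : H))
    rw [map_mul]
    rfl
  map_star' a := by
    rw [ContinuousLinearMap.star_eq_adjoint, ContinuousLinearMap.eq_adjoint_iff]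
    intro x y
    change inner ℂ (ρ (star a) (x : H)) (y : H) = inner ℂ (x : H) (ρ a (y : H))
    rw [map_star, ContinuousLinearMap.star_eq_adjoint, ContinuousLinearMap.adjoint_inner_left]

/-- `H_𝒥` is invariant under every bounded operator that maps `𝒥 H` to `H_𝒥`. -/
theorem localSpace_invariant_of {ρ : A →⋆ₙₐ[ℂ] (H →L[ℂ] H)} {𝒥 : NonUnitalStarSubalgebra ℂ A}
    (B : H →L[ℂ] H) (hB : ∀ j ∈ 𝒥, ∀ v, B (ρ j v) ∈ localSpace ρ 𝒥) :
    ∀ x ∈ localSpace ρ 𝒥, B x ∈ localSpace ρ 𝒥 := by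
  have h : localSpace ρ 𝒥 ≤ (localSpace ρ 𝒥).comap (B : H →ₗ[ℂ] H) := by
    refine Submodule.topologicalClosure_minimal _ ?_ ?_
    · refine Submodule.span_le.2 ?_
      rintro x ⟨j, hj, w, -, rfl⟩
      exact hB j hj w
    · exact (Submodule.isClosed_topologicalClosure _).preimage B.continuous
  exact fun x hx => h hx

theorem mem_localSpace {ρ : A →⋆ₙₐ[ℂ] (H →L[ℂ] H)} {𝒥 : NonUnitalStarSubalgebra ℂ A}
    {j : A} (hj : j ∈ 𝒥) (v : H) : ρ j v ∈ localSpace ρ 𝒥 :=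
  Submodule.le_topologicalClosure _ (Submodule.subset_span ⟨j, hj, v, trivial, rfl⟩)

theorem localSpace_invariant (ρ : A →⋆ₙₐ[ℂ] (H →L[ℂ] H)) {𝒜 𝒥 : NonUnitalStarSubalgebra ℂ A}
    (hd : Dense (𝒜 : Set A)) (hJ : IsStarIdeal 𝒥 𝒜) (a : A) :
    ∀ x ∈ localSpace ρ 𝒥, ρ a x ∈ localSpace ρ 𝒥 := by
  refine localSpace_invariant_of (ρ a) fun j hj v => ?_
  have hc : Continuous fun b : A => ρ b (ρ j v) :=
    (ContinuousLinearMap.apply ℂ H (ρ j v)).continuous.comp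
      (AddMonoidHomClass.continuous_of_bound ρ 1 fun b => by
        simpa using NonUnitalStarAlgHom.norm_apply_le ρ b)
  have hcl : IsClosed {b : A | ρ b (ρ j v) ∈ localSpace ρ 𝒥} :=
    (Submodule.isClosed_topologicalClosure _).preimage hc
  refine hcl.closure_subset_iff.2 (fun b hb => ?_) (hd a)
  have h : ρ b (ρ j v) = ρ (b * j) v := by rw [map_mul]; rfl
  change ρ b (ρ j v) ∈ localSpace ρ 𝒥
  rw [h]
  exact mem_localSpace (hJ.mul_left b hb j hj) v

/-- The representation of `A` on `H_𝒥` obtained by restricting `ρ`. -/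
def localRep (ρ : A →⋆ₙₐ[ℂ] (H →L[ℂ] H)) {𝒜 𝒥 : NonUnitalStarSubalgebra ℂ A}
    (hd : Dense (𝒜 : Set A)) (hJ : IsStarIdeal 𝒥 𝒜) :
    A →⋆ₙₐ[ℂ] (localSpace ρ 𝒥 →L[ℂ] localSpace ρ 𝒥) :=
  subrep ρ (localSpace ρ 𝒥) (localSpace_invariant ρ hd hJ)

/-- The restriction to `H_𝒥` of a grading operator on `H`. -/
def localGrading {ρ : A →⋆ₙₐ[ℂ] (H →L[ℂ] H)} {D : H →ₗ.[ℂ] H} (𝒥 : NonUnitalStarSubalgebra ℂ A)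
    {γ : H →L[ℂ] H} (hγ : IsGrading γ ρ D) : localSpace ρ 𝒥 →L[ℂ] localSpace ρ 𝒥 :=
  (γ ∘L (localSpace ρ 𝒥).subtypeL).codRestrict (localSpace ρ 𝒥) fun x =>
    localSpace_invariant_of γ (fun j hj v => by
      have h := congrArg (fun B : H →L[ℂ] H => B v) (hγ.even j)
      simp only [ContinuousLinearMap.comp_apply] at h
      rw [h]
      exact mem_localSpace hj (γ v)) x x.2

/-- The restriction of `D` to `𝒥 dom D`, as an unbounded operator on `H_𝒥`. If `D` is local with
respect to `𝒥`, then `D` maps `𝒥 dom D` to `H_𝒥`, and the domain is all of `𝒥 dom D`;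
see `mem_localPreOp_domain`. -/
def localPreOp (ρ : A →⋆ₙₐ[ℂ] (H →L[ℂ] H)) (𝒥 : NonUnitalStarSubalgebra ℂ A)
    (D : H →ₗ.[ℂ] H) : localSpace ρ 𝒥 →ₗ.[ℂ] localSpace ρ 𝒥 :=
  partIn (D.domRestrict (idealSpan ρ 𝒥 D.domain)) (localSpace ρ 𝒥)

theorem mem_localPreOp_domain {ρ : A →⋆ₙₐ[ℂ] (H →L[ℂ] H)} {𝒥 : NonUnitalStarSubalgebra ℂ A}
    {D : H →ₗ.[ℂ] H} (hD : IsLocal ρ 𝒥 D) (x : localSpace ρ 𝒥) :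
    x ∈ (localPreOp ρ 𝒥 D).domain ↔ (x : H) ∈ idealSpan ρ 𝒥 D.domain := by
  constructor
  · rintro ⟨h, -⟩
    exact h.1
  · intro hx
    have key : ∀ z ∈ idealSpan ρ 𝒥 D.domain,
        ∃ h : z ∈ D.domain, D ⟨z, h⟩ ∈ localSpace ρ 𝒥 := by
      intro z hz
      induction hz using Submodule.span_induction with
      | mem z hz =>
        obtain ⟨j, hj, w, hw, rfl⟩ := hz
        obtain ⟨k, hk, -, hkj⟩ := hD j hj
        obtain ⟨h, hDj⟩ := hkj w hw
        exact ⟨h, hDj ▸ mem_localSpace hk _⟩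
      | zero =>
        have h0 : D ⟨0, D.domain.zero_mem⟩ = 0 := D.map_zero
        exact ⟨D.domain.zero_mem, by rw [h0]; exact Submodule.zero_mem _⟩
      | add u v _ _ hu hv =>
        obtain ⟨hu, hu'⟩ := hu
        obtain ⟨hv, hv'⟩ := hv
        have h := D.map_add ⟨u, hu⟩ ⟨v, hv⟩
        exact ⟨D.domain.add_mem hu hv, h ▸ Submodule.add_mem _ hu' hv'⟩
      | smul c u _ hu =>
        obtain ⟨hu, hu'⟩ := hu
        have h := D.map_smul c ⟨u, hu⟩
        exact ⟨D.domain.smul_mem c hu, h ▸ Submodule.smul_mem _ c hu'⟩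
    obtain ⟨h, h'⟩ := key x hx
    refine ⟨⟨hx, h⟩, ?_⟩
    exact h'

/-- The operator `D_𝒥` on `H_𝒥`, the closure of the restriction of `D` to `𝒥 dom D`. -/
def localOp (ρ : A →⋆ₙₐ[ℂ] (H →L[ℂ] H)) (𝒥 : NonUnitalStarSubalgebra ℂ A)
    (D : H →ₗ.[ℂ] H) : localSpace ρ 𝒥 →ₗ.[ℂ] localSpace ρ 𝒥 :=
  (localPreOp ρ 𝒥 D).closure

end Triples

end

end RelSpectral

open RelSpectral

namespace RelSpectral

/-! ### Powers, interpolation and compactness of bounded operators -/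

section BoundedOperators

open ContinuousLinearMap

variable {H : Type*} [NormedAddCommGroup H] [InnerProductSpace ℂ H] [CompleteSpace H]
variable {K : Type*} [NormedAddCommGroup K] [InnerProductSpace ℂ K] [CompleteSpace K]

/-! Write G = (1+D²)⁻¹, S = G^(1/2), G_𝒥 = (1+D_𝒥*D_𝒥)⁻¹, δ = 1/(2 max(m,1)) and e = 1/2 − δ. Then
[D,ρ(a)]G^e is given by a bounded operator T; for m < 1 the commutator itself is bounded, which is
the reason for max(m,1).

Compactness and boundedness pass from D to D_𝒥 by comparing resolvents. As D_𝒥 is a restriction of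
D, the operator G_𝒥, extended by zero to H, is at most G (`conj_oneAddInv_le`). The Löwner–Heinz
inequality and Douglas' lemma then give G_𝒥^s = G^s C with C bounded, for 0 ≤ s ≤ 1/2
(`exists_localOp_rpow_factor`). If A is unital, the unit acts as the identity on H_𝒥, so G_𝒥 is
compact, and the spare factor G_𝒥^δ makes the commutator relatively compact.

The hard point is that ρ(j) maps dom D_𝒥* into dom D_𝒥. Since [D,ρ(j)] may be unbounded, one duality
argument does not suffice, and the regularity of ρ(j)x is raised along the ranges of G^κ up to ran S
= dom D. If ρ(i)x ∈ ran G^κ for all i ∈ 𝒥, with κ ≤ e, then ρ(j)x ∈ ran G^(κ+δ)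
(`adjoint_regularity_step`): locality gives [D,ρ(j*)] = ρ(k)[D,ρ(j*)], so in the pairing with x the
vector x may be replaced by ρ(k*)x, whose regularity is known. Using it requires moving G^κ past T,
that is, G^κ T = X G^κ with X bounded. For κ = e this is [D,a]* = −[D,a*]
(`commutatorBound_adjoint`); dyadic fractions of e follow by interpolation
(`exists_intertwine_of_pow`). -/

theorem rpow_add_of_nonneg (G : H →L[ℂ] H) {s t : ℝ} (hs : 0 ≤ s) (ht : 0 ≤ t) :
    G ^ (s + t) = G ^ s * G ^ t := by
  simp only [CFC.rpow_def]
  rw [← cfc_mul _ _ G (NNReal.continuous_rpow_const hs).continuousOn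
    (NNReal.continuous_rpow_const ht).continuousOn]
  exact cfc_congr fun x _ => NNReal.rpow_add_of_nonneg x hs ht

theorem rpow_add_apply (G : H →L[ℂ] H) {s t : ℝ} (hs : 0 ≤ s) (ht : 0 ≤ t) (x : H) :
    (G ^ (s + t)) x = (G ^ s) ((G ^ t) x) := by
  rw [rpow_add_of_nonneg G hs ht]
  rfl

theorem isSelfAdjoint_rpow (G : H →L[ℂ] H) (s : ℝ) : IsSelfAdjoint (G ^ s) :=
  IsSelfAdjoint.of_nonneg CFC.rpow_nonneg

theorem inner_left_of_isSelfAdjoint {B : H →L[ℂ] H} (hB : IsSelfAdjoint B) (x y : H) :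
    inner ℂ (B x) y = inner ℂ x (B y) :=
  (ContinuousLinearMap.isSelfAdjoint_iff_isSymmetric.1 hB) x y

/-- For an integer n ≥ s, the injective operator G^n factors as G^(n−s) G^s. -/
theorem injective_rpow {G : H →L[ℂ] H} (hG : 0 ≤ G) (hi : Function.Injective G) {s : ℝ}
    (hs : 0 ≤ s) : Function.Injective (G ^ s : H →L[ℂ] H) := by
  obtain ⟨n, hn⟩ := exists_nat_ge s
  have h : G ^ n = G ^ ((n : ℝ) - s) * G ^ s := by
    rw [← rpow_add_of_nonneg G (sub_nonneg.2 hn) hs, sub_add_cancel, CFC.rpow_natCast G n hG]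
  have hin : Function.Injective (G ^ n : H →L[ℂ] H) := by
    rw [FunLike.coe_pow_eq_iterate]
    exact hi.iterate n
  rw [h] at hin
  exact Function.Injective.of_comp (f := (G ^ ((n : ℝ) - s) : H →L[ℂ] H)) hin

theorem denseRange_of_isSelfAdjoint {B : H →L[ℂ] H} (hB : IsSelfAdjoint B)
    (hi : Function.Injective B) : DenseRange B := by
  have h : (LinearMap.range (B : H →ₗ[ℂ] H))ᗮ = ⊥ := by
    rw [ContinuousLinearMap.orthogonal_range,
      ContinuousLinearMap.isSelfAdjoint_iff'.1 hB, LinearMap.ker_eq_bot]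
    exact hi
  have h2 := Submodule.topologicalClosure_eq_top_iff.2 h
  exact (Submodule.dense_iff_topologicalClosure_eq_top (s := LinearMap.range (B : H →ₗ[ℂ] H))).2 h2

theorem denseRange_rpow {G : H →L[ℂ] H} (hG : 0 ≤ G) (hi : Function.Injective G) {s : ℝ}
    (hs : 0 ≤ s) : DenseRange (G ^ s : H →L[ℂ] H) :=
  denseRange_of_isSelfAdjoint (isSelfAdjoint_rpow G s) (injective_rpow hG hi hs)

omit [CompleteSpace H] in
/-- Douglas' factorization lemma for an operator `B` with dense range. -/
theorem exists_factor {A : H →ₗ[ℂ] K} {B : H →L[ℂ] H} (hB : DenseRange B) (c : ℝ)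
    (h : ∀ x, ‖A x‖ ≤ c * ‖B x‖) : ∃ X : H →L[ℂ] K, ∀ x, X (B x) = A x :=
  ⟨A.extendOfNorm (B : H →ₗ[ℂ] H), fun x =>
    LinearMap.extendOfNorm_eq (e := (B : H →ₗ[ℂ] H)) hB ⟨c, h⟩ x⟩

/-- A symmetrizable operator is bounded for the symmetrizing seminorm. -/
theorem norm_le_of_symmetrizable {Q R : H →L[ℂ] H} (hQ : IsSelfAdjoint Q)
    (h : Q * Q * R = adjoint R * (Q * Q)) (x : H) : ‖Q (R x)‖ ≤ ‖R‖ * ‖Q x‖ := by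
  -- `R` is symmetric for the semi-inner product ⟨Q·, Q·⟩. Cauchy–Schwarz for this form, iterated
  -- along the powers 2^n, reduces the claim to a crude bound on `R ^ (2 ^ n)`.
  have hsym : ∀ u v, inner ℂ (Q (R u)) (Q v) = inner ℂ (Q u) (Q (R v)) := fun u v => by
    have h1 : Q (Q (R u)) = adjoint R (Q (Q u)) := congrArg (fun B : H →L[ℂ] H => B u) h
    rw [← inner_left_of_isSelfAdjoint hQ, h1, ContinuousLinearMap.adjoint_inner_left,
      inner_left_of_isSelfAdjoint hQ]
  have hsymn : ∀ (n : ℕ) u v, inner ℂ (Q ((R ^ n) u)) (Q v) = inner ℂ (Q u) (Q ((R ^ n) v)) := by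
    intro n
    induction n with
    | zero => intro u v; rfl
    | succ n ih =>
      intro u v
      rw [pow_succ]
      change inner ℂ (Q ((R ^ n) (R u))) (Q v) = inner ℂ (Q u) (Q ((R ^ n) (R v)))
      rw [ih, hsym]
      congr 2
      change (R * R ^ n) v = (R ^ n * R) v
      rw [← pow_succ', pow_succ]
  have hsq : ∀ n, ‖Q ((R ^ n) x)‖ ^ 2 ≤ ‖Q ((R ^ (2 * n)) x)‖ * ‖Q x‖ := fun n => by
    have h1 : inner ℂ (Q ((R ^ n) x)) (Q ((R ^ n) x)) = inner ℂ (Q x) (Q ((R ^ (2 * n)) x)) := by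
      rw [hsymn, two_mul, pow_add]
      rfl
    rw [inner_self_eq_norm_sq_to_K] at h1
    have h2 := norm_inner_le_norm (𝕜 := ℂ) (Q x) (Q ((R ^ (2 * n)) x))
    rw [← h1] at h2
    simpa [mul_comm] using h2
  rcases (norm_nonneg (Q x)).eq_or_lt with h0 | h0
  · have := hsq 1
    rw [← h0] at this ⊢
    simp only [pow_one, mul_zero] at this ⊢
    nlinarith [norm_nonneg (Q (R x))]
  have hpow : ∀ n : ℕ, ‖Q (R x)‖ ^ (2 ^ n) ≤ ‖Q ((R ^ (2 ^ n)) x)‖ * ‖Q x‖ ^ (2 ^ n - 1) := by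
    intro n
    induction n with
    | zero => simp
    | succ n ih =>
      have hn : 1 ≤ 2 ^ n := Nat.one_le_two_pow
      calc ‖Q (R x)‖ ^ (2 ^ (n + 1)) = (‖Q (R x)‖ ^ (2 ^ n)) ^ 2 := by rw [← pow_mul, pow_succ]
        _ ≤ (‖Q ((R ^ (2 ^ n)) x)‖ * ‖Q x‖ ^ (2 ^ n - 1)) ^ 2 := by gcongr
        _ = ‖Q ((R ^ (2 ^ n)) x)‖ ^ 2 * ‖Q x‖ ^ (2 * (2 ^ n - 1)) := by
          rw [mul_pow, ← pow_mul, mul_comm 2]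
        _ ≤ (‖Q ((R ^ (2 * 2 ^ n)) x)‖ * ‖Q x‖) * ‖Q x‖ ^ (2 * (2 ^ n - 1)) := by
          gcongr
          exact hsq _
        _ = ‖Q ((R ^ (2 ^ (n + 1))) x)‖ * ‖Q x‖ ^ (2 ^ (n + 1) - 1) := by
          have h2 : 2 * (2 ^ n - 1) + 1 = 2 * 2 ^ n - 1 := by omega
          rw [mul_assoc, ← pow_succ' ‖Q x‖, pow_succ' 2 n, h2]
  by_contra! hlt
  rcases (norm_nonneg R).eq_or_lt with hR | hR
  · have hR0 : R = 0 := norm_eq_zero.1 hR.symm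
    simp [hR0] at hlt
  -- If the claim failed, this quotient would exceed 1, while its powers with exponents 2^n stay
  -- bounded independently of n.
  set q := ‖Q (R x)‖ / (‖R‖ * ‖Q x‖) with hq
  have hq1 : 1 < q := (one_lt_div (by positivity)).2 hlt
  have hbd : ∀ n : ℕ, q ^ (2 ^ n) ≤ ‖Q‖ * ‖x‖ / ‖Q x‖ := fun n => by
    have hn : 1 ≤ 2 ^ n := Nat.one_le_two_pow
    rw [hq, div_pow, div_le_div_iff₀ (by positivity) h0, mul_pow]
    have h1 : ‖Q ((R ^ (2 ^ n)) x)‖ ≤ ‖Q‖ * (‖R‖ ^ (2 ^ n) * ‖x‖) := by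
      refine (Q.le_opNorm _).trans ?_
      gcongr
      refine ((R ^ (2 ^ n)).le_opNorm x).trans ?_
      gcongr
      exact norm_pow_le' R (by omega)
    calc ‖Q (R x)‖ ^ (2 ^ n) * ‖Q x‖
        ≤ ‖Q ((R ^ (2 ^ n)) x)‖ * ‖Q x‖ ^ (2 ^ n - 1) * ‖Q x‖ := by gcongr; exact hpow n
      _ = ‖Q ((R ^ (2 ^ n)) x)‖ * ‖Q x‖ ^ (2 ^ n) := by
        rw [mul_assoc, ← pow_succ, Nat.sub_add_cancel hn]
      _ ≤ ‖Q‖ * (‖R‖ ^ (2 ^ n) * ‖x‖) * ‖Q x‖ ^ (2 ^ n) := by gcongr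
      _ = ‖Q‖ * ‖x‖ * (‖R‖ ^ (2 ^ n) * ‖Q x‖ ^ (2 ^ n)) := by ring
  obtain ⟨N, hN⟩ := pow_unbounded_of_one_lt (‖Q‖ * ‖x‖ / ‖Q x‖) hq1
  have h3 : q ^ N ≤ q ^ (2 ^ N) := pow_le_pow_right₀ hq1.le N.lt_two_pow_self.le
  linarith [hbd N]

/-- Interpolation at the midpoint. -/
theorem exists_intertwine_of_sq {Q T T' : H →L[ℂ] H} (hQ : IsSelfAdjoint Q) (hd : DenseRange Q)
    (h : Q * Q * T = T' * (Q * Q)) : ∃ X : H →L[ℂ] H, Q * T = X * Q := by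
  have hQ' : star Q = Q := hQ
  have hst : star T * (Q * Q) = Q * Q * star T' := by
    have := congrArg star h
    simpa only [star_mul, hQ'] using this
  -- Since ‖QTx‖² = ⟨T'Q²x, Tx⟩ = ⟨Qx, QRx⟩ for R = T'*T, a bound of `R` in the seminorm ‖Q·‖ gives
  -- one of `T`.
  set R := star T' * T with hR
  have hRs : Q * Q * R = adjoint R * (Q * Q) := by
    rw [← ContinuousLinearMap.star_eq_adjoint, hR, star_mul, star_star, ← mul_assoc, ← hst,
      mul_assoc, h, mul_assoc]
  have key : ∀ x, ‖(Q * T) x‖ ≤ √‖R‖ * ‖Q x‖ := fun x => by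
    have h1 : inner ℂ (Q (T x)) (Q (T x)) = inner ℂ (Q x) (Q (R x)) := by
      have h2 : Q (Q (T x)) = T' (Q (Q x)) := congrArg (fun B : H →L[ℂ] H => B x) h
      rw [← inner_left_of_isSelfAdjoint hQ, h2, ← ContinuousLinearMap.adjoint_inner_right,
        inner_left_of_isSelfAdjoint hQ]
      rfl
    have h3 := norm_inner_le_norm (𝕜 := ℂ) (Q x) (Q (R x))
    rw [← h1, inner_self_eq_norm_sq_to_K] at h3
    have h4 : ‖Q (T x)‖ ^ 2 ≤ ‖Q x‖ * ‖Q (R x)‖ := by simpa using h3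
    have h5 := norm_le_of_symmetrizable hQ hRs x
    refine abs_le_of_sq_le_sq' ?_ (by positivity) |>.2
    rw [mul_pow, Real.sq_sqrt (norm_nonneg _)]
    refine h4.trans ?_
    nlinarith [norm_nonneg (Q x)]
  obtain ⟨X, hX⟩ := exists_factor (A := ((Q * T : H →L[ℂ] H) : H →ₗ[ℂ] H)) hd _ key
  exact ⟨X, by ext x; exact (hX x).symm⟩

/-- Interpolation at dyadic points. -/
theorem exists_intertwine_of_pow {Q : H →L[ℂ] H} (hQ : IsSelfAdjoint Q)
    (hi : Function.Injective Q) (n : ℕ) :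
    ∀ {T T' : H →L[ℂ] H}, Q ^ (2 ^ n) * T = T' * Q ^ (2 ^ n) → ∀ k ≤ 2 ^ n,
      ∃ X : H →L[ℂ] H, Q ^ k * T = X * Q ^ k := by
  induction n with
  | zero =>
    intro T T' h k hk
    interval_cases k
    · exact ⟨T, by simp⟩
    · exact ⟨T', by simpa using h⟩
  | succ n ih =>
    intro T T' h k hk
    set P := Q ^ (2 ^ n) with hP
    have hPP : Q ^ (2 ^ (n + 1)) = P * P := by rw [hP, ← pow_add, pow_succ, mul_two]
    have hPs : IsSelfAdjoint P := hQ.pow _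
    have hPi : Function.Injective P := by
      rw [hP, FunLike.coe_pow_eq_iterate]
      exact hi.iterate _
    have hPd := denseRange_of_isSelfAdjoint hPs hPi
    rw [hPP] at h
    obtain ⟨X, hX⟩ := exists_intertwine_of_sq hPs hPd h
    rcases le_total k (2 ^ n) with hk' | hk'
    · exact ih hX k hk'
    -- The midpoint operator `X` splits the problem: the pair (T, X) serves exponents up to 2^n, the
    -- pair (X, T') the remaining ones.
    · have hX' : P * X = T' * P := by
        refine DFunLike.coe_injective (hPd.equalizer (P * X).continuous (T' * P).continuous ?_)
        ext x
        have h1 : (P * (X * P)) x = (T' * (P * P)) x := by rw [← hX, ← mul_assoc, h]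
        exact h1
      obtain ⟨Y, hY⟩ := ih hX' (k - 2 ^ n) (by rw [pow_succ] at hk; omega)
      refine ⟨Y, ?_⟩
      have hk2 : Q ^ k = Q ^ (k - 2 ^ n) * P := by rw [hP, ← pow_add, Nat.sub_add_cancel hk']
      rw [hk2, mul_assoc, hX, ← mul_assoc, hY, mul_assoc]

/-- From ‖B(x−y)‖² ≤ ‖B²(x−y)‖ ‖x−y‖ and ‖x−y‖ ≤ 2 on the unit ball, centres of an ε²/2-net for the
image under B² give an ε-net for the image under B. -/
theorem isCompactOperator_of_mul_self {B : H →L[ℂ] H} (hB : IsSelfAdjoint B)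
    (h : IsCompactOperator (B * B : H →L[ℂ] H)) : IsCompactOperator B := by
  have h1 := (isCompactOperator_iff_isCompact_closure_image_closedBall
    ((B * B : H →L[ℂ] H) : H →ₗ[ℂ] H) one_pos).1 h
  refine (isCompactOperator_iff_isCompact_closure_image_closedBall
    (B : H →ₗ[ℂ] H) one_pos).2 ?_
  refine isCompact_iff_totallyBounded_isComplete.2
    ⟨TotallyBounded.closure ?_, isClosed_closure.isComplete⟩
  have h2 := h1.totallyBounded.subset subset_closure
  rw [Metric.totallyBounded_iff]
  intro ε hε
  obtain ⟨t, hts, htf, ht⟩ := h2.exists_subset (Metric.dist_mem_uniformity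
    (show (0 : ℝ) < ε ^ 2 / 2 by positivity))
  obtain ⟨s, hs, hsf, rfl⟩ := Set.exists_subset_image_finite_and.1 ⟨t, hts, htf, rfl⟩
  refine ⟨B '' s, hsf.image _, ?_⟩
  rintro _ ⟨x, hx, rfl⟩
  obtain ⟨_, ⟨y, hy, rfl⟩, hxy⟩ := Set.mem_iUnion₂.1 (ht ⟨x, hx, rfl⟩)
  refine Set.mem_iUnion₂.2 ⟨B y, ⟨y, hy, rfl⟩, ?_⟩
  have hxy' : ‖B (B x) - B (B y)‖ < ε ^ 2 / 2 := by
    rw [← dist_eq_norm]; exact hxy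
  have hle : ‖B (x - y)‖ ^ 2 ≤ ‖B (B (x - y))‖ * ‖x - y‖ := by
    have h3 := norm_inner_le_norm (𝕜 := ℂ) (B (B (x - y))) (x - y)
    rw [inner_left_of_isSelfAdjoint hB, inner_self_eq_norm_sq_to_K] at h3
    simpa using h3
  have hn : ‖x - y‖ ≤ 2 := by
    refine (norm_sub_le x y).trans ?_
    have := mem_closedBall_zero_iff.1 hx
    have := mem_closedBall_zero_iff.1 (hs hy)
    linarith
  rw [map_sub, map_sub] at hle
  rw [Metric.mem_ball, dist_eq_norm]
  change ‖B x - B y‖ < ε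
  refine lt_of_pow_lt_pow_left₀ 2 hε.le ?_
  nlinarith [norm_nonneg (B (B x) - B (B y)), norm_nonneg (x - y)]

/-- Repeated square roots give compactness for the exponents 2^(−n), and G^s has such a power as a
factor. -/
theorem isCompactOperator_rpow {G : H →L[ℂ] H} (hG : 0 ≤ G) (h : IsCompactOperator G) {s : ℝ}
    (hs : 0 < s) : IsCompactOperator (G ^ s : H →L[ℂ] H) := by
  have key : ∀ n : ℕ, IsCompactOperator (G ^ ((1 / 2 : ℝ) ^ n) : H →L[ℂ] H) := by
    intro n
    induction n with
    | zero => simpa [CFC.rpow_one G hG] using h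
    | succ n ih =>
      refine isCompactOperator_of_mul_self (isSelfAdjoint_rpow G _) ?_
      rw [← rpow_add_of_nonneg G (by positivity) (by positivity)]
      convert ih using 3
      ring
  obtain ⟨n, hn⟩ := exists_pow_lt_of_lt_one hs (by norm_num : (1 / 2 : ℝ) < 1)
  have h1 : G ^ s = G ^ ((1 / 2 : ℝ) ^ n) * G ^ (s - (1 / 2 : ℝ) ^ n) := by
    rw [← rpow_add_of_nonneg G (by positivity) (by linarith), add_sub_cancel]
  rw [h1]
  exact (key n).comp_clm (G ^ (s - (1 / 2 : ℝ) ^ n))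

/-- Conjugation by an isometry, as a homomorphism. -/
noncomputable def conjHom (V : K →L[ℂ] H) (hV : adjoint V ∘L V = .id ℂ K) :
    (K →L[ℂ] K) →⋆ₙₐ[ℂ] (H →L[ℂ] H) where
  toFun B := V ∘L B ∘L adjoint V
  map_smul' c B := by ext; simp
  map_zero' := by ext; simp
  map_add' B C := by ext; simp
  map_mul' B C := by
    ext x
    have h : adjoint V (V (C (adjoint V x))) = C (adjoint V x) :=
      congrArg (fun T : K →L[ℂ] K => T (C (adjoint V x))) hV
    change V (B (C (adjoint V x))) = V (B (adjoint V (V (C (adjoint V x)))))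
    rw [h]
  map_star' B := by
    simp only [ContinuousLinearMap.star_eq_adjoint, ContinuousLinearMap.adjoint_comp,
      ContinuousLinearMap.adjoint_adjoint]
    rfl

theorem conj_nonneg (V : K →L[ℂ] H) {B : K →L[ℂ] K} (hB : 0 ≤ B) : 0 ≤ V ∘L B ∘L adjoint V := by
  rw [ContinuousLinearMap.nonneg_iff_isPositive] at hB ⊢
  exact hB.conj_adjoint V

/-- Conjugation by V is multiplicative but need not preserve the unit, so it commutes with the
functional calculus only for functions vanishing at 0; hence s > 0. -/
theorem conj_rpow (V : K →L[ℂ] H) (hV : adjoint V ∘L V = .id ℂ K) {B : K →L[ℂ] K} (hB : 0 ≤ B)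
    {s : ℝ} (hs : 0 < s) : V ∘L (B ^ s : K →L[ℂ] K) ∘L adjoint V = (V ∘L B ∘L adjoint V) ^ s := by
  lift s to NNReal using hs.le
  have hs' : 0 < s := hs
  rw [← CFC.nnrpow_eq_rpow hs', ← CFC.nnrpow_eq_rpow hs', CFC.nnrpow_def, CFC.nnrpow_def]
  have hc : Continuous (conjHom V hV) := by
    change Continuous fun B : K →L[ℂ] K => V ∘L B ∘L adjoint V
    fun_prop
  exact NonUnitalStarAlgHom.map_cfcₙ (conjHom V hV) _ B
    (NNReal.continuous_nnrpow_const s).continuousOn (by simp [hs'.ne']) hc hB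
    (conj_nonneg V hB)

theorem inner_rpow_self (G : H →L[ℂ] H) {s : ℝ} (hs : 0 ≤ s) (x : H) :
    inner ℂ ((G ^ s) x) x = (‖(G ^ (s / 2)) x‖ ^ 2 : ℂ) := by
  have h : (G ^ s) x = (G ^ (s / 2)) ((G ^ (s / 2)) x) := by
    rw [← rpow_add_apply G (by positivity) (by positivity), add_halves]
  rw [h, inner_left_of_isSelfAdjoint (isSelfAdjoint_rpow G _), inner_self_eq_norm_sq_to_K]
  rfl

/-- The Heinz inequality, as a factorization. -/
theorem exists_rpow_factor (V : K →L[ℂ] H) (hV : adjoint V ∘L V = .id ℂ K) {B : K →L[ℂ] K}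
    (hB : 0 ≤ B) {G : H →L[ℂ] H} (hG : 0 ≤ G) (hi : Function.Injective G)
    (hle : V ∘L B ∘L adjoint V ≤ G) {s : ℝ} (hs0 : 0 ≤ s) (hs1 : s ≤ 1) :
    ∃ C : K →L[ℂ] H, ∀ x, V ((B ^ (s / 2) : K →L[ℂ] K) x) = (G ^ (s / 2)) (C x) := by
  rcases hs0.eq_or_lt with rfl | hs
  · exact ⟨V, fun x => by simp [CFC.rpow_zero, hB, hG]⟩
  -- Löwner–Heinz: V B^s V* ≤ G^s, hence ‖B^(s/2) V* x‖ ≤ ‖G^(s/2) x‖. Douglas' lemma gives B^(s/2)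
  -- V* = X G^(s/2), and taking adjoints yields the factorization with C = X*.
  have h1 := CFC.rpow_le_rpow ⟨hs0, hs1⟩ hle
  rw [← conj_rpow V hV hB hs, ContinuousLinearMap.le_def] at h1
  have h2 : ∀ x, ‖(B ^ (s / 2)) (adjoint V x)‖ ≤ 1 * ‖(G ^ (s / 2)) x‖ := fun x => by
    have h3 := h1.re_inner_nonneg_left x
    rw [sub_apply, inner_sub_left, inner_rpow_self G hs0] at h3
    change 0 ≤ RCLike.re (_ - inner ℂ (V ((B ^ s) (adjoint V x))) x) at h3
    rw [← ContinuousLinearMap.adjoint_inner_right, inner_rpow_self B hs0] at h3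
    have h4 : (0 : ℝ) ≤ ‖(G ^ (s / 2)) x‖ ^ 2 - ‖(B ^ (s / 2)) (adjoint V x)‖ ^ 2 := by
      exact_mod_cast h3
    rw [one_mul]
    exact abs_le_of_sq_le_sq' (by linarith) (norm_nonneg _) |>.2
  obtain ⟨X, hX⟩ := exists_factor (A := (((B ^ (s / 2) : K →L[ℂ] K) ∘L adjoint V) : H →ₗ[ℂ] K))
    (denseRange_rpow hG hi (s := s / 2) (by positivity)) 1 h2
  refine ⟨adjoint X, fun x => ext_inner_right ℂ fun y => ?_⟩
  rw [inner_left_of_isSelfAdjoint (isSelfAdjoint_rpow G _),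
    ContinuousLinearMap.adjoint_inner_left, hX, ← ContinuousLinearMap.adjoint_inner_right,
    inner_left_of_isSelfAdjoint (isSelfAdjoint_rpow B _)]
  rfl

end BoundedOperators

/-! ### Graphs of unbounded operators, resolvents and bounded transforms -/

section UnboundedOperators

open ContinuousLinearMap

variable {H : Type*} [NormedAddCommGroup H] [InnerProductSpace ℂ H]

theorem mem_graph_bdd {B : H →L[ℂ] H} {x y : H} : (x, y) ∈ (bdd B).graph ↔ B x = y := by
  rw [LinearPMap.mem_graph_iff]
  constructor
  · rintro ⟨z, rfl, h⟩
    exact h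
  · intro h
    exact ⟨⟨x, trivial⟩, rfl, h⟩

/-- Membership in graphs replaces evaluation at vectors bundled with domain proofs; domain
conditions then become the existence of intermediate vectors. -/
theorem mem_graph_pcomp {S T : H →ₗ.[ℂ] H} {x z : H} :
    (x, z) ∈ (pcomp S T).graph ↔ ∃ y, (x, y) ∈ T.graph ∧ (y, z) ∈ S.graph := by
  simp only [LinearPMap.mem_graph_iff]
  constructor
  · rintro ⟨⟨u, h, h'⟩, rfl, rfl⟩
    exact ⟨T ⟨u, h⟩, ⟨⟨u, h⟩, rfl, rfl⟩, ⟨T ⟨u, h⟩, h'⟩, rfl, rfl⟩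
  · rintro ⟨y, ⟨u, rfl, rfl⟩, ⟨v, hv, rfl⟩⟩
    refine ⟨⟨u, u.2, hv ▸ v.2⟩, rfl, ?_⟩
    change S ⟨T ⟨u, u.2⟩, _⟩ = S v
    congr 1
    exact Subtype.ext hv.symm

theorem mem_graph_opCommutator {D : H →ₗ.[ℂ] H} {B : H →L[ℂ] H} {x z : H} :
    (x, z) ∈ (opCommutator D B).graph ↔
      ∃ y y', (x, y) ∈ D.graph ∧ (B x, y') ∈ D.graph ∧ z = y' - B y := by
  rw [LinearPMap.mem_graph_iff]
  constructor
  · rintro ⟨⟨u, hu⟩, rfl, rfl⟩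
    have h1 : u ∈ (pcomp D (bdd B)).domain := hu.1
    have h2 : u ∈ (pcomp (bdd B) D).domain := hu.2
    obtain ⟨b, hb, hy⟩ := mem_graph_pcomp.1 ((LinearPMap.image_iff h1).1 rfl)
    obtain ⟨y, hy', hz⟩ := mem_graph_pcomp.1 ((LinearPMap.image_iff h2).1 rfl)
    rw [mem_graph_bdd] at hb hz
    subst hb
    refine ⟨_, _, hy', hy, ?_⟩
    rw [hz]
    rfl
  · rintro ⟨y, y', h1, h2, rfl⟩
    have h3 : (x, y') ∈ (pcomp D (bdd B)).graph := mem_graph_pcomp.2 ⟨B x, mem_graph_bdd.2 rfl, h2⟩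
    have h4 : (x, B y) ∈ (pcomp (bdd B) D).graph := mem_graph_pcomp.2 ⟨y, h1, mem_graph_bdd.2 rfl⟩
    have h5 := LinearPMap.mem_domain_of_mem_graph h3
    have h6 := LinearPMap.mem_domain_of_mem_graph h4
    refine ⟨⟨x, h5, h6⟩, rfl, ?_⟩
    rw [(LinearPMap.image_iff h5).2 h3, (LinearPMap.image_iff h6).2 h4]
    rfl

theorem le_bdd_iff {T : H →ₗ.[ℂ] H} {B : H →L[ℂ] H} :
    T ≤ bdd B ↔ ∀ x y, (x, y) ∈ T.graph → B x = y := by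
  rw [← LinearPMap.le_graph_iff]
  exact ⟨fun h x y hxy => mem_graph_bdd.1 (h hxy), fun h ⟨x, y⟩ hxy => mem_graph_bdd.2 (h x y hxy)⟩

theorem eq_bdd_iff {T : H →ₗ.[ℂ] H} {B : H →L[ℂ] H} :
    T = bdd B ↔ ∀ x, (x, B x) ∈ T.graph := by
  constructor
  · rintro rfl x
    exact mem_graph_bdd.2 rfl
  · intro h
    refine LinearPMap.eq_of_eq_graph (le_antisymm ?_ ?_)
    · rintro ⟨x, y⟩ hxy
      exact mem_graph_bdd.2 (LinearPMap.mem_graph_snd_inj _ (h x) hxy rfl)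
    · rintro ⟨x, y⟩ hxy
      rw [← mem_graph_bdd.1 hxy]
      exact h x

theorem IsSymmetric.inner_graph {D : H →ₗ.[ℂ] H} (hD : IsSymmetric D) {x x' y y' : H}
    (hx : (x, x') ∈ D.graph) (hy : (y, y') ∈ D.graph) : inner ℂ x' y = inner ℂ x y' := by
  obtain ⟨u, rfl, rfl⟩ := D.mem_graph_iff.1 hx
  obtain ⟨v, rfl, rfl⟩ := D.mem_graph_iff.1 hy
  exact hD u v

variable [CompleteSpace H]

theorem inner_adjoint_graph {T : H →ₗ.[ℂ] H} (hd : Dense (T.domain : Set H)) {x x' y y' : H}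
    (hx : (x, x') ∈ T.graph) (hy : (y, y') ∈ T.adjoint.graph) : inner ℂ y' x = inner ℂ y x' := by
  obtain ⟨u, rfl, rfl⟩ := T.mem_graph_iff.1 hx
  obtain ⟨v, rfl, rfl⟩ := T.adjoint.mem_graph_iff.1 hy
  exact T.adjoint_isFormalAdjoint hd v u

theorem mem_adjoint_graph {T : H →ₗ.[ℂ] H} (hd : Dense (T.domain : Set H)) {y y' : H}
    (h : ∀ x x', (x, x') ∈ T.graph → inner ℂ y' x = inner ℂ y x') : (y, y') ∈ T.adjoint.graph := by
  have h1 : ∀ x : T.domain, inner ℂ y' (x : H) = inner ℂ y (T x) := fun x => h _ _ (T.mem_graph x)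
  have h2 := T.mem_adjoint_domain_of_exists y ⟨y', h1⟩
  rw [LinearPMap.mem_graph_iff]
  exact ⟨⟨y, h2⟩, rfl, LinearPMap.adjoint_apply_eq hd ⟨y, h2⟩ h1⟩

variable {T : H →ₗ.[ℂ] H}

theorem oneAddInv_graph (hT : T.IsClosed) (hd : Dense (T.domain : Set H)) (x : H) :
    ∃ v t, (oneAddInv T x, v) ∈ T.graph ∧ (v, t) ∈ T.adjoint.graph ∧ oneAddInv T x + t = x := by
  obtain ⟨h, h', hx⟩ := oneAddInv_spec hT hd x
  exact ⟨_, _, T.mem_graph ⟨_, h⟩, T.adjoint.mem_graph ⟨_, h'⟩, hx⟩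

theorem inner_oneAddInv (hT : T.IsClosed) (hd : Dense (T.domain : Set H)) {x v y y' : H}
    (hv : (oneAddInv T x, v) ∈ T.graph) (hy : (y, y') ∈ T.graph) :
    inner ℂ x y = inner ℂ (oneAddInv T x) y + inner ℂ v y' := by
  obtain ⟨v', t, h1, h2, h3⟩ := oneAddInv_graph hT hd x
  obtain rfl := LinearPMap.mem_graph_snd_inj _ hv h1 rfl
  rw [← inner_adjoint_graph hd hy h2, ← inner_add_left, h3]

theorem inner_oneAddInv_self (hT : T.IsClosed) (hd : Dense (T.domain : Set H)) {x v : H}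
    (hv : (oneAddInv T x, v) ∈ T.graph) :
    inner ℂ x (oneAddInv T x) = ((‖oneAddInv T x‖ ^ 2 + ‖v‖ ^ 2 : ℝ) : ℂ) := by
  rw [inner_oneAddInv hT hd hv hv, inner_self_eq_norm_sq_to_K, inner_self_eq_norm_sq_to_K]
  push_cast
  rfl

theorem oneAddInv_nonneg (hT : T.IsClosed) (hd : Dense (T.domain : Set H)) : 0 ≤ oneAddInv T := by
  rw [ContinuousLinearMap.nonneg_iff_isPositive, ContinuousLinearMap.isPositive_iff_complex]
  intro x
  obtain ⟨v, t, h1, -, -⟩ := oneAddInv_graph hT hd x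
  have h := inner_oneAddInv_self hT hd h1
  have h2 : inner ℂ (oneAddInv T x) x = ((‖oneAddInv T x‖ ^ 2 + ‖v‖ ^ 2 : ℝ) : ℂ) := by
    rw [← inner_conj_symm, h, Complex.conj_ofReal]
  rw [h2]
  have h3 : (0 : ℝ) ≤ ‖oneAddInv T x‖ ^ 2 + ‖v‖ ^ 2 := by positivity
  exact ⟨rfl, h3⟩

theorem oneAddInv_injective (hT : T.IsClosed) (hd : Dense (T.domain : Set H)) :
    Function.Injective (oneAddInv T) := by
  rw [injective_iff_map_eq_zero]
  intro x hx
  obtain ⟨v, t, h1, h2, h3⟩ := oneAddInv_graph hT hd x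
  rw [hx] at h1 h3
  obtain rfl : v = 0 := LinearPMap.mem_graph_snd_inj _ h1 T.graph.zero_mem rfl
  obtain rfl : t = 0 := LinearPMap.mem_graph_snd_inj _ h2 T.adjoint.graph.zero_mem rfl
  rw [← h3, add_zero]

theorem oneAddInvSqrt_mul_self (hT : T.IsClosed) (hd : Dense (T.domain : Set H)) (x : H) :
    oneAddInvSqrt T (oneAddInvSqrt T x) = oneAddInv T x := by
  rw [oneAddInvSqrt, ← rpow_add_apply _ (by norm_num) (by norm_num), add_halves,
    CFC.rpow_one _ (oneAddInv_nonneg hT hd)]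

theorem oneAddInvSqrt_isSelfAdjoint (T : H →ₗ.[ℂ] H) : IsSelfAdjoint (oneAddInvSqrt T) :=
  isSelfAdjoint_rpow _ _

theorem oneAddInvSqrt_injective (hT : T.IsClosed) (hd : Dense (T.domain : Set H)) :
    Function.Injective (oneAddInvSqrt T) :=
  injective_rpow (oneAddInv_nonneg hT hd) (oneAddInv_injective hT hd) (by norm_num)

theorem oneAddInvSqrt_denseRange (hT : T.IsClosed) (hd : Dense (T.domain : Set H)) :
    DenseRange (oneAddInvSqrt T) :=
  denseRange_rpow (oneAddInv_nonneg hT hd) (oneAddInv_injective hT hd) (by norm_num)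

/-- The domain of `T` is the range of `(1 + T*T)^(-1/2)`, and `F = T (1 + T*T)^(-1/2)` is
bounded. -/
theorem exists_boundedTransform (hT : T.IsClosed) (hd : Dense (T.domain : Set H)) :
    ∃ F : H →L[ℂ] H, (∀ w, (oneAddInvSqrt T w, F w) ∈ T.graph) ∧
      ∀ y y', (y, y') ∈ T.graph → y = oneAddInvSqrt T (oneAddInvSqrt T y + adjoint F y') := by
  have hSS := oneAddInvSqrt_mul_self hT hd
  have hSs : IsSelfAdjoint (oneAddInvSqrt T) := oneAddInvSqrt_isSelfAdjoint T
  have hSd : DenseRange (oneAddInvSqrt T) := oneAddInvSqrt_denseRange hT hd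
  set S := oneAddInvSqrt T with hS
  have hdom : ∀ x, oneAddInv T x ∈ T.domain := fun x => (oneAddInv_spec hT hd x).1
  set A : H →ₗ[ℂ] H :=
    T.toFun ∘ₗ LinearMap.codRestrict T.domain (oneAddInv T : H →ₗ[ℂ] H) hdom with hA
  have hAg : ∀ x, (oneAddInv T x, A x) ∈ T.graph := fun x => T.mem_graph ⟨_, hdom x⟩
  -- From ⟨x, Gx⟩ = ‖Gx‖² + ‖TGx‖² with G = S²; this bound lets TG factor as FS.
  have hle : ∀ x, ‖A x‖ ≤ 1 * ‖S x‖ := fun x => by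
    have h1 := inner_oneAddInv_self hT hd (hAg x)
    rw [← hSS x, ← inner_left_of_isSelfAdjoint hSs,
      inner_self_eq_norm_sq_to_K] at h1
    have h2 : ‖S x‖ ^ 2 = ‖S (S x)‖ ^ 2 + ‖A x‖ ^ 2 :=
      Complex.ofReal_injective (by push_cast at h1 ⊢; exact h1)
    rw [one_mul]
    exact abs_le_of_sq_le_sq' (by nlinarith [sq_nonneg ‖S (S x)‖]) (norm_nonneg _) |>.2
  obtain ⟨F, hF⟩ := exists_factor hSd 1 hle
  -- Known on the dense range of S, where FS = TG; it extends to all of H because the graph is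
  -- closed.
  have hg : ∀ w, (S w, F w) ∈ T.graph := fun w => by
    have hcl : IsClosed {w | (S w, F w) ∈ T.graph} :=
      hT.preimage (S.continuous.prodMk F.continuous)
    refine hcl.closure_subset_iff.2 ?_ (hSd w)
    rintro _ ⟨x, rfl⟩
    change (S (S x), F (S x)) ∈ T.graph
    rw [hF, hSS]
    exact hAg x
  refine ⟨F, hg, fun y y' hy => ext_inner_left ℂ fun z => ?_⟩
  rw [← inner_left_of_isSelfAdjoint hSs, inner_add_right, ContinuousLinearMap.adjoint_inner_right,
    hF, inner_oneAddInv hT hd (hAg z) hy, ← inner_left_of_isSelfAdjoint hSs,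
    hSS]

theorem range_oneAddInvSqrt (hT : T.IsClosed) (hd : Dense (T.domain : Set H)) {y : H} :
    y ∈ T.domain ↔ ∃ w, y = oneAddInvSqrt T w := by
  obtain ⟨F, h1, h2⟩ := exists_boundedTransform hT hd
  constructor
  · intro hy
    exact ⟨_, h2 y _ (T.mem_graph ⟨y, hy⟩)⟩
  · rintro ⟨w, rfl⟩
    exact LinearPMap.mem_domain_of_mem_graph (h1 w)

/-- `oneAddInv T` is a left inverse of `1 + T*T`. -/
theorem oneAddInv_eq_of_graph (hT : T.IsClosed) (hd : Dense (T.domain : Set H)) {u v t : H}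
    (hu : (u, v) ∈ T.graph) (hv : (v, t) ∈ T.adjoint.graph) : u = oneAddInv T (u + t) := by
  refine ext_inner_left ℂ fun z => ?_
  obtain ⟨v', t', h1, h2, h3⟩ := oneAddInv_graph hT hd z
  have hG : IsSelfAdjoint (oneAddInv T) := IsSelfAdjoint.of_nonneg (oneAddInv_nonneg hT hd)
  rw [inner_oneAddInv hT hd h1 hu, ← inner_left_of_isSelfAdjoint hG, inner_add_right]
  congr 1
  rw [← inner_conj_symm, ← inner_adjoint_graph hd h1 hv, inner_conj_symm]

/-- This is S² + F*F = 1, obtained by cancelling the injective S in the formula of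
`exists_boundedTransform` for y = Sw. -/
theorem norm_sq_boundedTransform (hT : T.IsClosed) (hd : Dense (T.domain : Set H)) {w w' : H}
    (h : (oneAddInvSqrt T w, w') ∈ T.graph) :
    ‖oneAddInvSqrt T w‖ ^ 2 + ‖w'‖ ^ 2 = ‖w‖ ^ 2 := by
  obtain ⟨F, h1, h2⟩ := exists_boundedTransform hT hd
  obtain rfl := LinearPMap.mem_graph_snd_inj _ h (h1 w) rfl
  have h3 := oneAddInvSqrt_injective hT hd (h2 _ _ (h1 w))
  have h4 : inner ℂ w w = inner ℂ (oneAddInvSqrt T (oneAddInvSqrt T w) + adjoint F (F w)) w := by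
    rw [← h3]
  rw [inner_add_left, inner_left_of_isSelfAdjoint (oneAddInvSqrt_isSelfAdjoint T),
    ContinuousLinearMap.adjoint_inner_left] at h4
  simp only [inner_self_eq_norm_sq_to_K] at h4
  have h5 : ‖w‖ ^ 2 = ‖oneAddInvSqrt T w‖ ^ 2 + ‖F w‖ ^ 2 := by exact_mod_cast h4
  exact h5.symm

/-- The bounded transform of a self-adjoint operator. -/
theorem exists_boundedTransform_selfAdjoint {D : H →ₗ.[ℂ] H} (hD : D.adjoint = D)
    (hd : Dense (D.domain : Set H)) :
    ∃ F : H →L[ℂ] H, (∀ w, (oneAddInvSqrt D w, F w) ∈ D.graph) ∧ IsSelfAdjoint F ∧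
      Commute (oneAddInv D) F ∧ ∀ x, x = oneAddInv D x + F (F x) := by
  have hcl : D.IsClosed := hD ▸ D.adjoint_isClosed hd
  obtain ⟨F, h1, h2⟩ := exists_boundedTransform hcl hd
  have hSd := oneAddInvSqrt_denseRange hcl hd
  have hSs := oneAddInvSqrt_isSelfAdjoint D
  have hSi := oneAddInvSqrt_injective hcl hd
  -- G commutes with D: if q = DGy, then Dq = y − Gy lies in dom D and D²q = Dy − q, so q + D²q = Dy
  -- and q = G Dy.
  have hGD : ∀ y y', (y, y') ∈ D.graph → (oneAddInv D y, oneAddInv D y') ∈ D.graph := by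
    intro y y' hy
    obtain ⟨q, r, hq, hr, hqr⟩ := oneAddInv_graph hcl hd y
    rw [hD] at hr
    have hr' : (r, y' - q) ∈ D.graph := by
      have h3 := D.graph.sub_mem hy hq
      have h4 : (y, y') - (oneAddInv D y, q) = (r, y' - q) :=
        Prod.ext (by rw [Prod.fst_sub, sub_eq_iff_eq_add', hqr]) rfl
      rwa [h4] at h3
    have h3 := oneAddInv_eq_of_graph hcl hd hr (hD.symm ▸ hr')
    rw [add_sub_cancel] at h3
    rwa [← h3]
  have hcomm : Commute (oneAddInv D) F := by
    change oneAddInv D * F = F * oneAddInv D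
    ext w
    refine LinearPMap.mem_graph_snd_inj _ (hGD _ _ (h1 w)) (h1 (oneAddInv D w)) ?_
    rw [← oneAddInvSqrt_mul_self hcl hd, ← oneAddInvSqrt_mul_self hcl hd]
  have hcommS : Commute (oneAddInvSqrt D) F := by
    rw [oneAddInvSqrt, CFC.rpow_def]
    exact hcomm.cfc_nnreal _
  have hFs : IsSelfAdjoint F := by
    rw [ContinuousLinearMap.isSelfAdjoint_iff_isSymmetric]
    intro x y
    change inner ℂ (F x) y = inner ℂ x (F y)
    have hfun := hSd.equalizer (g := fun y => inner ℂ (F x) y) (h := fun y => inner ℂ x (F y))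
      (by fun_prop) (by fun_prop) ?_
    · exact congrFun hfun y
    · funext w
      change inner ℂ (F x) (oneAddInvSqrt D w) = inner ℂ x (F (oneAddInvSqrt D w))
      have h4 : (oneAddInvSqrt D x, F x) ∈ D.adjoint.graph := by rw [hD]; exact h1 x
      have h3 := inner_adjoint_graph hd (h1 w) h4
      rw [h3, inner_left_of_isSelfAdjoint hSs]
      exact congrArg (fun B : H →L[ℂ] H => inner ℂ x (B w)) hcommS
  refine ⟨F, h1, hFs, hcomm, fun x => ?_⟩
  have h3 := hSi (h2 _ _ (h1 x))
  rwa [ContinuousLinearMap.isSelfAdjoint_iff'.1 hFs, oneAddInvSqrt_mul_self hcl hd] at h3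

end UnboundedOperators

/-! ### Bounds on the commutators [D, ρ(a)] -/

section CommutatorBound

open ContinuousLinearMap

variable {H : Type*} [NormedAddCommGroup H] [InnerProductSpace ℂ H] [CompleteSpace H]

/-- `B` preserves `dom D`, and `[D, B] (1 + D*D)^(-e)` is given by the bounded operator `T`. -/
def IsCommutatorBound (D : H →ₗ.[ℂ] H) (B : H →L[ℂ] H) (e : ℝ) (T : H →L[ℂ] H) : Prop :=
  ∀ z y, ((oneAddInv D ^ e) z, y) ∈ D.graph → (B ((oneAddInv D ^ e) z), B y + T z) ∈ D.graph

theorem rpow_pow (G : H →L[ℂ] H) (hG : 0 ≤ G) {s : ℝ} (hs : 0 ≤ s) (k : ℕ) :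
    (G ^ s) ^ k = G ^ (s * k) := by
  rw [← CFC.rpow_natCast (G ^ s) k CFC.rpow_nonneg,
    CFC.rpow_rpow_of_exponent_nonneg G s k hs k.cast_nonneg hG]

variable {A : Type*} [NonUnitalCStarAlgebra A] {ρ : A →⋆ₙₐ[ℂ] (H →L[ℂ] H)}
  {𝒜 : NonUnitalStarSubalgebra ℂ A} {D : H →ₗ.[ℂ] H} {m : ℝ}

theorem IsHigherOrderSpectralTriple.isClosed_op (hT : IsHigherOrderSpectralTriple ρ 𝒜 D m) :
    D.IsClosed :=
  hT.selfAdjoint ▸ D.adjoint_isClosed hT.dense_domain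

theorem IsHigherOrderSpectralTriple.symmetric (hT : IsHigherOrderSpectralTriple ρ 𝒜 D m) :
    IsSymmetric D := fun x y => by
  have hy : ((y : H), D y) ∈ D.adjoint.graph := by
    rw [hT.selfAdjoint]
    exact D.mem_graph y
  have h := inner_adjoint_graph hT.dense_domain (D.mem_graph x) hy
  rw [← inner_conj_symm, ← h, inner_conj_symm]

theorem IsHigherOrderSpectralTriple.oneAddInv_nonneg
    (hT : IsHigherOrderSpectralTriple ρ 𝒜 D m) : 0 ≤ oneAddInv D :=
  RelSpectral.oneAddInv_nonneg hT.isClosed_op hT.dense_domain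

theorem IsHigherOrderSpectralTriple.oneAddInv_injective
    (hT : IsHigherOrderSpectralTriple ρ 𝒜 D m) : Function.Injective (oneAddInv D) :=
  RelSpectral.oneAddInv_injective hT.isClosed_op hT.dense_domain

/-- For m ≥ 1 the exponent is that of the definition. For m < 1 it is 0, and the hypothesis even
bounds the commutator composed with a positive, unbounded power of 1+D². -/
theorem IsHigherOrderSpectralTriple.exists_commutatorBound
    (hT : IsHigherOrderSpectralTriple ρ 𝒜 D m) {a : A} (ha : a ∈ 𝒜) :
    ∃ T, IsCommutatorBound D (ρ a) (1 / 2 - 1 / (2 * max m 1)) T := by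
  have hm := hT.order_pos
  have key : ∀ {e : ℝ} (T : H →L[ℂ] H),
      (∀ z c, ((oneAddInv D ^ e) z, c) ∈ (opCommutator D (ρ a)).graph → T z = c) →
      IsCommutatorBound D (ρ a) e T := by
    intro e T h z y hy
    have hd := hT.map_domain a ha _ (LinearPMap.mem_domain_of_mem_graph hy)
    have h1 := h z _ (mem_graph_opCommutator.2 ⟨y, D ⟨_, hd⟩, hy, D.mem_graph ⟨_, hd⟩, rfl⟩)
    rw [h1, add_sub_cancel]
    exact D.mem_graph ⟨_, hd⟩
  obtain ⟨B, hB⟩ := hT.bounded_commutator a ha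
  rw [le_bdd_iff] at hB
  rcases le_or_gt 1 m with h1 | h1
  · refine ⟨B, key B fun z c hc => hB z c (mem_graph_pcomp.2 ⟨_, ?_, hc⟩)⟩
    have hle : -(1 / 2 : ℝ) + 1 / (2 * m) ≤ 0 := by
      rw [neg_add_nonpos_iff]
      exact one_div_le_one_div_of_le two_pos (by linarith)
    rw [oneAddPow, if_pos hle, mem_graph_bdd, max_eq_left h1]
    congr 3
    ring
  · have hlt : 0 < -(1 / 2 : ℝ) + 1 / (2 * m) := by
      rw [lt_neg_add_iff_add_lt, add_zero]
      exact one_div_lt_one_div_of_lt (by positivity) (by linarith)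
    set t := -(1 / 2 : ℝ) + 1 / (2 * m) with ht
    -- (1+D²)^t sends G^t z back to z, so evaluating the hypothesis at G^t z gives [D,ρ(a)]z = B G^t
    -- z.
    refine ⟨B ∘L (oneAddInv D ^ t), key _ fun z c hc =>
      hB _ c (mem_graph_pcomp.2 ⟨z, ?_, ?_⟩)⟩
    · have hker : LinearMap.ker (bdd (oneAddInv D ^ t)).toFun = ⊥ := by
        rw [LinearMap.ker_eq_bot]
        intro x y hxy
        exact Subtype.ext (injective_rpow hT.oneAddInv_nonneg hT.oneAddInv_injective hlt.le hxy)
      rw [oneAddPow, if_neg hlt.not_ge, LinearPMap.inverse_graph hker]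
      exact ⟨(z, (oneAddInv D ^ t) z), mem_graph_bdd.2 rfl, rfl⟩
    · have h0 : (1 / 2 : ℝ) - 1 / (2 * max m 1) = 0 := by rw [max_eq_right h1.le]; norm_num
      rw [h0, CFC.rpow_zero _ hT.oneAddInv_nonneg] at hc
      exact hc

/-- This is [D,a]* = −[D,a*]: symmetry of D is tested on the vectors Sz and Su with S = G^e G^δ, and
the factors G^δ are removed by density of their range. -/
theorem IsHigherOrderSpectralTriple.commutatorBound_adjoint
    (hT : IsHigherOrderSpectralTriple ρ 𝒜 D m) {a : A} {e δ : ℝ} (he : 0 ≤ e) (hδ : 0 ≤ δ)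
    (heδ : e + δ = 1 / 2) {T T' : H →L[ℂ] H} (h : IsCommutatorBound D (ρ a) e T)
    (h' : IsCommutatorBound D (ρ (star a)) e T') :
    oneAddInv D ^ e * T = -adjoint T' * oneAddInv D ^ e := by
  set G := oneAddInv D with hG
  have hG0 : 0 ≤ G := hT.oneAddInv_nonneg
  have hGi : Function.Injective G := hT.oneAddInv_injective
  obtain ⟨F, hF, -⟩ := exists_boundedTransform hT.isClosed_op hT.dense_domain
  have hS : ∀ u, oneAddInvSqrt D u = (G ^ e) ((G ^ δ) u) := fun u => by
    rw [oneAddInvSqrt, ← heδ, rpow_add_apply G he hδ]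
  simp only [hS] at hF
  have hadj : ∀ x y, inner ℂ (ρ a x) y = inner ℂ x (ρ (star a) y) := fun x y => by
    rw [map_star, ContinuousLinearMap.star_eq_adjoint, ContinuousLinearMap.adjoint_inner_right]
  have key : ∀ z u, inner ℂ ((G ^ e) (T ((G ^ δ) z))) ((G ^ δ) u) =
      inner ℂ ((-adjoint T') ((G ^ e) ((G ^ δ) z))) ((G ^ δ) u) := fun z u => by
    have h1 := hT.symmetric.inner_graph (h _ _ (hF z)) (hF u)
    have h2 := hT.symmetric.inner_graph (hF z) (h' _ _ (hF u))
    rw [inner_add_left, hadj, hadj] at h1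
    rw [inner_add_right] at h2
    rw [inner_left_of_isSelfAdjoint (isSelfAdjoint_rpow G e), neg_apply, inner_neg_left,
      ContinuousLinearMap.adjoint_inner_left]
    linear_combination h1 - h2
  have hR := denseRange_rpow hG0 hGi hδ
  refine DFunLike.coe_injective (hR.equalizer (by fun_prop) (by fun_prop) ?_)
  funext z
  exact hR.eq_of_inner_left ℂ fun u => key z u

end CommutatorBound

/-! ### The operator D_𝒥, its resolvent and the domain of its adjoint -/

section LocalOperator

open ContinuousLinearMap

variable {A : Type*} [NonUnitalCStarAlgebra A]
  {H : Type*} [NormedAddCommGroup H] [InnerProductSpace ℂ H] [CompleteSpace H]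
  {ρ : A →⋆ₙₐ[ℂ] (H →L[ℂ] H)} {𝒜 𝒥 : NonUnitalStarSubalgebra ℂ A} {D : H →ₗ.[ℂ] H} {m : ℝ}

theorem mem_idealSpan {W : Submodule ℂ H} {j : A} (hj : j ∈ 𝒥) {w : H} (hw : w ∈ W) :
    ρ j w ∈ idealSpan ρ 𝒥 W :=
  Submodule.subset_span ⟨j, hj, w, hw, rfl⟩

theorem map_mem_idealSpan {W : Submodule ℂ H} (B : H →L[ℂ] H)
    (hB : ∀ j ∈ 𝒥, ∀ w ∈ W, B (ρ j w) ∈ idealSpan ρ 𝒥 W) {z : H} (hz : z ∈ idealSpan ρ 𝒥 W) :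
    B z ∈ idealSpan ρ 𝒥 W := by
  have h : idealSpan ρ 𝒥 W ≤ (idealSpan ρ 𝒥 W).comap (B : H →ₗ[ℂ] H) := by
    refine Submodule.span_le.2 ?_
    rintro x ⟨j, hj, w, hw, rfl⟩
    exact hB j hj w hw
  exact h hz

theorem rep_mem_idealSpan (hJ : IsStarIdeal 𝒥 𝒜) {W : Submodule ℂ H} {a : A} (ha : a ∈ 𝒜) {z : H}
    (hz : z ∈ idealSpan ρ 𝒥 W) : ρ a z ∈ idealSpan ρ 𝒥 W := by
  refine map_mem_idealSpan (ρ a) (fun j hj w hw => ?_) hz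
  have h : ρ a (ρ j w) = ρ (a * j) w := by rw [map_mul]; rfl
  rw [h]
  exact mem_idealSpan (hJ.mul_left a ha j hj) hw

theorem mem_graph_localPreOp (hloc : IsLocal ρ 𝒥 D) {x y : localSpace ρ 𝒥} :
    (x, y) ∈ (localPreOp ρ 𝒥 D).graph ↔
      (x : H) ∈ idealSpan ρ 𝒥 D.domain ∧ ((x : H), (y : H)) ∈ D.graph := by
  constructor
  · intro h
    have hx := LinearPMap.mem_domain_of_mem_graph h
    have hy := (LinearPMap.image_iff hx).2 h
    refine ⟨(mem_localPreOp_domain hloc x).1 hx, ?_⟩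
    rw [hy]
    exact D.mem_graph ⟨(x : H), hx.1.2⟩
  · rintro ⟨hx, hxy⟩
    have hx' := (mem_localPreOp_domain hloc x).2 hx
    rw [← LinearPMap.image_iff hx']
    exact Subtype.ext ((LinearPMap.image_iff hx'.1.2).2 hxy)

theorem IsLocal.exists_localPreOp_graph (hloc : IsLocal ρ 𝒥 D) {z : H}
    (hz : z ∈ idealSpan ρ 𝒥 D.domain) :
    ∃ x y : localSpace ρ 𝒥, (x : H) = z ∧ (x, y) ∈ (localPreOp ρ 𝒥 D).graph := by
  have hzK : z ∈ localSpace ρ 𝒥 := by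
    refine Submodule.le_topologicalClosure _ (Submodule.span_mono ?_ hz)
    rintro _ ⟨j, hj, w, -, rfl⟩
    exact ⟨j, hj, w, trivial, rfl⟩
  have hx := (mem_localPreOp_domain hloc ⟨z, hzK⟩).2 hz
  exact ⟨⟨z, hzK⟩, _, rfl, LinearPMap.mem_graph _ ⟨_, hx⟩⟩

theorem dense_localPreOp_domain (hd : Dense (D.domain : Set H)) (hloc : IsLocal ρ 𝒥 D) :
    Dense ((localPreOp ρ 𝒥 D).domain : Set (localSpace ρ 𝒥)) := by
  have h1 : localSpace ρ 𝒥 ≤ (idealSpan ρ 𝒥 D.domain).topologicalClosure := by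
    refine Submodule.topologicalClosure_minimal _ ?_ (Submodule.isClosed_topologicalClosure _)
    refine Submodule.span_le.2 ?_
    rintro x ⟨j, hj, w, -, rfl⟩
    have hcl : IsClosed {w | ρ j w ∈ (idealSpan ρ 𝒥 D.domain).topologicalClosure} :=
      (Submodule.isClosed_topologicalClosure _).preimage (ρ j).continuous
    exact hcl.closure_subset_iff.2
      (fun v hv => Submodule.le_topologicalClosure _ (mem_idealSpan hj hv)) (hd w)
  intro x
  rw [closure_subtype]
  refine closure_mono ?_ (h1 x.2)
  intro z hz
  obtain ⟨u, v, rfl, huv⟩ := hloc.exists_localPreOp_graph hz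
  exact ⟨u, LinearPMap.mem_domain_of_mem_graph huv, rfl⟩

/-- The restriction is symmetric and densely defined, hence contained in its adjoint, which is
closed. -/
theorem isClosable_localPreOp (hd : Dense (D.domain : Set H)) (hs : IsSymmetric D)
    (hloc : IsLocal ρ 𝒥 D) : (localPreOp ρ 𝒥 D).IsClosable := by
  have hd' := dense_localPreOp_domain hd hloc
  refine ((localPreOp ρ 𝒥 D).adjoint_isClosed hd').isClosable.leIsClosable ?_
  refine LinearPMap.le_of_le_graph ?_
  rintro ⟨y, y'⟩ hy
  refine mem_adjoint_graph hd' fun x x' hx => ?_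
  exact hs.inner_graph ((mem_graph_localPreOp hloc).1 hy).2 ((mem_graph_localPreOp hloc).1 hx).2

/-- A closed relation that contains the graph of `D` on `𝒥 dom D` contains the graph of its
closure. -/
theorem localOp_graph_induction (hd : Dense (D.domain : Set H)) (hs : IsSymmetric D)
    (hloc : IsLocal ρ 𝒥 D) {P : Set (localSpace ρ 𝒥 × localSpace ρ 𝒥)} (hP : IsClosed P)
    (h : ∀ p ∈ (localPreOp ρ 𝒥 D).graph, p ∈ P) : ∀ p ∈ (localOp ρ 𝒥 D).graph, p ∈ P := by
  intro p hp
  rw [localOp, ← (isClosable_localPreOp hd hs hloc).graph_closure_eq_closure_graph] at hp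
  exact hP.closure_subset_iff.2 h hp

theorem localPreOp_graph_le : (localPreOp ρ 𝒥 D).graph ≤ (localOp ρ 𝒥 D).graph :=
  LinearPMap.le_graph_of_le (LinearPMap.le_closure _)

theorem isClosed_localOp (hd : Dense (D.domain : Set H)) (hs : IsSymmetric D)
    (hloc : IsLocal ρ 𝒥 D) : (localOp ρ 𝒥 D).IsClosed :=
  (isClosable_localPreOp hd hs hloc).closure_isClosed

theorem dense_localOp_domain (hd : Dense (D.domain : Set H)) (hloc : IsLocal ρ 𝒥 D) :
    Dense ((localOp ρ 𝒥 D).domain : Set (localSpace ρ 𝒥)) :=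
  (dense_localPreOp_domain hd hloc).mono (LinearPMap.le_closure _).1

theorem localOp_graph_coe (hd : Dense (D.domain : Set H)) (hs : IsSymmetric D) (hcl : D.IsClosed)
    (hloc : IsLocal ρ 𝒥 D) {x y : localSpace ρ 𝒥} (h : (x, y) ∈ (localOp ρ 𝒥 D).graph) :
    ((x : H), (y : H)) ∈ D.graph := by
  have hP : IsClosed {p : localSpace ρ 𝒥 × localSpace ρ 𝒥 | ((p.1 : H), (p.2 : H)) ∈ D.graph} :=
    hcl.preimage (by fun_prop)
  exact localOp_graph_induction hd hs hloc hP
    (fun p hp => ((mem_graph_localPreOp hloc).1 hp).2) _ h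

theorem symmetric_localOp (hd : Dense (D.domain : Set H)) (hs : IsSymmetric D) (hcl : D.IsClosed)
    (hloc : IsLocal ρ 𝒥 D) : IsSymmetric (localOp ρ 𝒥 D) := fun x y =>
  hs.inner_graph (localOp_graph_coe hd hs hcl hloc (LinearPMap.mem_graph _ x))
    (localOp_graph_coe hd hs hcl hloc (LinearPMap.mem_graph _ y))

theorem localGrading_isGrading (hd : Dense (D.domain : Set H)) (hs : IsSymmetric D)
    (hloc : IsLocal ρ 𝒥 D) (hda : Dense (𝒜 : Set A)) (hJ : IsStarIdeal 𝒥 𝒜) {γ : H →L[ℂ] H}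
    (hγ : IsGrading γ ρ D) :
    IsGrading (localGrading 𝒥 hγ) (localRep ρ hda hJ) (localOp ρ 𝒥 D) where
  selfAdjoint := by
    rw [ContinuousLinearMap.isSelfAdjoint_iff_isSymmetric]
    intro x y
    exact inner_left_of_isSelfAdjoint hγ.selfAdjoint (x : H) (y : H)
  sq := by
    ext x
    exact congrArg (fun B : H →L[ℂ] H => B (x : H)) hγ.sq
  even a := by
    ext x
    exact congrArg (fun B : H →L[ℂ] H => B (x : H)) (hγ.even a)
  odd x := by
    set g := localGrading 𝒥 hγ with hg
    have hcoe : ∀ u, ((g u : localSpace ρ 𝒥) : H) = γ (u : H) := fun u => rfl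
    have hD : ∀ {u v : H}, (u, v) ∈ D.graph → (γ u, -γ v) ∈ D.graph := by
      intro u v huv
      obtain ⟨w, rfl, rfl⟩ := D.mem_graph_iff.1 huv
      obtain ⟨h, h'⟩ := hγ.odd w
      rw [← h']
      exact D.mem_graph ⟨_, h⟩
    have hP : IsClosed {p : localSpace ρ 𝒥 × localSpace ρ 𝒥 |
        (g p.1, -g p.2) ∈ (localOp ρ 𝒥 D).graph} :=
      (isClosed_localOp hd hs hloc).preimage (by fun_prop)
    have h1 := localOp_graph_induction hd hs hloc hP (fun p hp => ?_) _
      (LinearPMap.mem_graph _ x)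
    · have h2 := LinearPMap.mem_domain_of_mem_graph h1
      exact ⟨h2, ((LinearPMap.image_iff h2).2 h1).symm⟩
    · obtain ⟨hp1, hp2⟩ := (mem_graph_localPreOp hloc).1 hp
      refine localPreOp_graph_le ((mem_graph_localPreOp hloc).2 ⟨?_, hD hp2⟩)
      rw [hcoe]
      refine map_mem_idealSpan γ (fun j hj w hw => ?_) hp1
      have h3 : γ (ρ j w) = ρ j (γ w) := congrArg (fun B : H →L[ℂ] H => B w) (hγ.even j)
      rw [h3]
      exact mem_idealSpan hj (hγ.odd ⟨w, hw⟩).1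

/-- On dom D the vector Dρ(a)y depends continuously on the pair (y, Dy), so invariance of 𝒥 dom D
under ρ(a) survives passage to the closure. -/
theorem localOp_map_graph (hT : IsHigherOrderSpectralTriple ρ 𝒜 D m) (hJ : IsStarIdeal 𝒥 𝒜)
    (hloc : IsLocal ρ 𝒥 D) {a : A} (ha : a ∈ 𝒜) {x y : localSpace ρ 𝒥}
    (h : (x, y) ∈ (localOp ρ 𝒥 D).graph) :
    ∃ z, (localRep ρ hT.dense_alg hJ a x, z) ∈ (localOp ρ 𝒥 D).graph := by
  obtain ⟨T, hTb⟩ := hT.exists_commutatorBound ha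
  set G := oneAddInv D with hG
  set δ := 1 / (2 * max m 1) with hδ
  have hM : 1 ≤ max m 1 := le_max_right _ _
  have hδ0 : 0 ≤ δ := by positivity
  have he : 0 ≤ 1 / 2 - δ := sub_nonneg.2 (one_div_le_one_div_of_le two_pos (by linarith))
  obtain ⟨F, -, hF⟩ := exists_boundedTransform hT.isClosed_op hT.dense_domain
  -- For y ∈ dom D one has y = S(Sy + F*Dy) and S = G^e G^δ, so this expression at (y, Dy) equals
  -- ρ(a)Dy + [D,ρ(a)]y = Dρ(a)y.
  set c : H × H → H := fun p => ρ a p.2 +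
    T ((G ^ δ) (oneAddInvSqrt D p.1 + adjoint F p.2)) with hc
  have hcc : Continuous c := by fun_prop
  have hcD : ∀ p ∈ D.graph, (ρ a p.1, c p) ∈ D.graph := by
    rintro ⟨u, v⟩ huv
    have hS : ∀ z, oneAddInvSqrt D z = (G ^ (1 / 2 - δ)) ((G ^ δ) z) := fun z => by
      rw [← rpow_add_apply G he hδ0, sub_add_cancel, oneAddInvSqrt]
    have h1 := (hF u v huv).trans (hS _)
    have h2 := hTb _ v (h1 ▸ huv)
    rw [← h1] at h2
    exact h2
  -- The projection only makes the second entry an element of H_𝒥; on the graph of the restriction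
  -- to 𝒥 dom D it changes nothing.
  have hP : IsClosed {p : localSpace ρ 𝒥 × localSpace ρ 𝒥 |
      (localRep ρ hT.dense_alg hJ a p.1,
        (localSpace ρ 𝒥).orthogonalProjectionOnto (c ((p.1 : H), (p.2 : H)))) ∈
          (localOp ρ 𝒥 D).graph} :=
    (isClosed_localOp hT.dense_domain hT.symmetric hloc).preimage (by fun_prop)
  refine ⟨_, localOp_graph_induction hT.dense_domain hT.symmetric hloc hP (fun p hp => ?_) _ h⟩
  obtain ⟨hp1, hp2⟩ := (mem_graph_localPreOp hloc).1 hp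
  obtain ⟨u, v, hu, huv⟩ := hloc.exists_localPreOp_graph (rep_mem_idealSpan hJ ha hp1)
  have hu' : localRep ρ hT.dense_alg hJ a p.1 = u := Subtype.ext hu.symm
  have hv : c ((p.1 : H), (p.2 : H)) = v :=
    LinearPMap.mem_graph_snd_inj _ (hcD _ hp2) ((mem_graph_localPreOp hloc).1 huv).2 hu.symm
  rw [Set.mem_ofPred_eq, hu', hv, Submodule.orthogonalProjectionOnto_mem_subspace_eq_self]
  exact localPreOp_graph_le huv

/-- With V the inclusion and u = G_𝒥V*x, the form of VG_𝒥V* at x is ‖u‖² + ‖Du‖², because D_𝒥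
restricts D. Writing u = Sw turns this into ‖w‖² = ⟨Sx, w⟩, whence ‖w‖² ≤ ‖Sx‖² = ⟨Gx, x⟩. -/
theorem conj_oneAddInv_le (hT : IsHigherOrderSpectralTriple ρ 𝒜 D m) (hloc : IsLocal ρ 𝒥 D) :
    (localSpace ρ 𝒥).subtypeL ∘L oneAddInv (localOp ρ 𝒥 D) ∘L
      adjoint (localSpace ρ 𝒥).subtypeL ≤ oneAddInv D := by
  have hd := dense_localOp_domain hT.dense_domain hloc
  have hcl := isClosed_localOp hT.dense_domain hT.symmetric hloc
  have h1 := conj_nonneg (localSpace ρ 𝒥).subtypeL (oneAddInv_nonneg hcl hd)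
  rw [ContinuousLinearMap.le_def, ContinuousLinearMap.isPositive_def']
  refine ⟨hT.oneAddInv_nonneg.isSelfAdjoint.sub h1.isSelfAdjoint, fun x => ?_⟩
  set x' := adjoint (localSpace ρ 𝒥).subtypeL x with hx'
  obtain ⟨v, t, hv, -, -⟩ := oneAddInv_graph hcl hd x'
  have h2 := inner_oneAddInv_self hcl hd hv
  set u := oneAddInv (localOp ρ 𝒥 D) x' with hu
  have h3 := localOp_graph_coe hT.dense_domain hT.symmetric hT.isClosed_op hloc hv
  obtain ⟨w, hw⟩ := (range_oneAddInvSqrt hT.isClosed_op hT.dense_domain).1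
    (LinearPMap.mem_domain_of_mem_graph h3)
  have h4 := norm_sq_boundedTransform hT.isClosed_op hT.dense_domain (hw ▸ h3)
  rw [← hw] at h4
  have h5 : inner ℂ x' u = inner ℂ x (u : H) := by
    rw [hx', ContinuousLinearMap.adjoint_inner_left]
    rfl
  have h6 : inner ℂ x (u : H) = ((‖w‖ ^ 2 : ℝ) : ℂ) := by
    rw [← h5, h2, ← h4]
    rfl
  have hSs := oneAddInvSqrt_isSelfAdjoint D
  have h7 : ‖w‖ ^ 2 ≤ ‖oneAddInvSqrt D x‖ * ‖w‖ := by
    have h8 := norm_inner_le_norm (𝕜 := ℂ) (oneAddInvSqrt D x) w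
    rw [inner_left_of_isSelfAdjoint hSs, ← hw, h6, Complex.norm_real] at h8
    exact (le_abs_self _).trans h8
  have h9 : ‖w‖ ≤ ‖oneAddInvSqrt D x‖ := by
    rcases (norm_nonneg w).eq_or_lt with h0 | h0
    · rw [← h0]; positivity
    · nlinarith
  have h10 : inner ℂ (oneAddInv D x) x = ((‖oneAddInvSqrt D x‖ ^ 2 : ℝ) : ℂ) := by
    rw [← oneAddInvSqrt_mul_self hT.isClosed_op hT.dense_domain, inner_left_of_isSelfAdjoint hSs,
      inner_self_eq_norm_sq_to_K]
    push_cast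
    rfl
  rw [ContinuousLinearMap.reApplyInnerSelf_apply, sub_apply, inner_sub_left, h10]
  have h11 : inner ℂ (((localSpace ρ 𝒥).subtypeL ∘L oneAddInv (localOp ρ 𝒥 D) ∘L
      adjoint (localSpace ρ 𝒥).subtypeL) x) x = ((‖w‖ ^ 2 : ℝ) : ℂ) := by
    change inner ℂ (u : H) x = _
    rw [← inner_conj_symm, h6, Complex.conj_ofReal]
  rw [h11, ← Complex.ofReal_sub]
  change (0 : ℝ) ≤ _
  have h12 := norm_nonneg w
  have : ‖w‖ ^ 2 ≤ ‖oneAddInvSqrt D x‖ ^ 2 := by gcongr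
  change 0 ≤ ‖oneAddInvSqrt D x‖ ^ 2 - ‖w‖ ^ 2
  linarith

/-- The Heinz factorization is applied with exponent 2s ≤ 1, so s = 1/2 is the largest power that
can be compared. -/
theorem exists_localOp_rpow_factor (hT : IsHigherOrderSpectralTriple ρ 𝒜 D m)
    (hloc : IsLocal ρ 𝒥 D) {s : ℝ} (hs0 : 0 ≤ s) (hs1 : s ≤ 1 / 2) :
    ∃ C : localSpace ρ 𝒥 →L[ℂ] H, ∀ x,
      ((oneAddInv (localOp ρ 𝒥 D) ^ s) x : H) = (oneAddInv D ^ s) (C x) := by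
  have hd := dense_localOp_domain hT.dense_domain hloc
  have hcl := isClosed_localOp hT.dense_domain hT.symmetric hloc
  have hV : adjoint (localSpace ρ 𝒥).subtypeL ∘L (localSpace ρ 𝒥).subtypeL = .id ℂ _ := by
    ext x
    refine congrArg Subtype.val (ext_inner_right ℂ fun y => ?_)
    change inner ℂ (adjoint (localSpace ρ 𝒥).subtypeL ((localSpace ρ 𝒥).subtypeL x)) y = _
    rw [ContinuousLinearMap.adjoint_inner_left]
    rfl
  obtain ⟨C, hC⟩ := exists_rpow_factor _ hV (oneAddInv_nonneg hcl hd) hT.oneAddInv_nonneg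
    hT.oneAddInv_injective (conj_oneAddInv_le hT hloc) (s := 2 * s) (by linarith) (by linarith)
  rw [mul_div_cancel_left₀ s two_ne_zero] at hC
  exact ⟨C, hC⟩

theorem inner_rep_left (ρ : A →⋆ₙₐ[ℂ] (H →L[ℂ] H)) (a : A) (u v : H) :
    inner ℂ (ρ a u) v = inner ℂ u (ρ (star a) v) := by
  rw [map_star, ContinuousLinearMap.star_eq_adjoint, ContinuousLinearMap.adjoint_inner_right]

theorem rep_rep (ρ : A →⋆ₙₐ[ℂ] (H →L[ℂ] H)) (a b : A) (v : H) : ρ a (ρ b v) = ρ (a * b) v := by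
  rw [map_mul]
  rfl

/-- The commutator of a local operator with `i ∈ 𝒥` is local. -/
theorem IsLocal.exists_commutator_eq (hloc : IsLocal ρ 𝒥 D) {i : A} (hi : i ∈ 𝒥) :
    ∃ k ∈ 𝒥, ∀ {z z' q : H}, (z, z') ∈ D.graph → (ρ i z, q) ∈ D.graph →
      ρ k (q - ρ i z') = q - ρ i z' := by
  obtain ⟨k, hk, hki, hkD⟩ := hloc i hi
  refine ⟨k, hk, fun {z z' q} hz hq => ?_⟩
  obtain ⟨h1, h2⟩ := hkD _ (LinearPMap.mem_domain_of_mem_graph hz)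
  rw [(LinearPMap.image_iff h1).2 hq, map_sub, ← h2, rep_rep, ← hki]

theorem inner_localOp_adjoint (hd : Dense (D.domain : Set H)) (hloc : IsLocal ρ 𝒥 D)
    {x x' p q : localSpace ρ 𝒥} (hx : (x, x') ∈ (localOp ρ 𝒥 D).adjoint.graph)
    (hp : (p, q) ∈ (localOp ρ 𝒥 D).graph) :
    inner ℂ (x' : H) (p : H) = inner ℂ (x : H) (q : H) := by
  have hd' := dense_localOp_domain hd hloc
  have h := inner_adjoint_graph (T := localOp ρ 𝒥 D) hd' hp hx
  exact h

/-- One step of the regularity argument for `dom D_𝒥*`. -/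
theorem adjoint_regularity_step (hT : IsHigherOrderSpectralTriple ρ 𝒜 D m)
    (hloc : IsLocal ρ 𝒥 D) {x x' : localSpace ρ 𝒥}
    (hx : (x, x') ∈ (localOp ρ 𝒥 D).adjoint.graph) {e δ κ : ℝ} (hδ : 0 ≤ δ)
    (heδ : e + δ = 1 / 2) (hκ : 0 ≤ κ) (hκe : κ ≤ e) {j : A} (hj : j ∈ 𝒥)
    {T X : H →L[ℂ] H} (hTb : IsCommutatorBound D (ρ (star j)) e T)
    (hX : oneAddInv D ^ κ * T = X * oneAddInv D ^ κ)
    (hreg : ∀ i ∈ 𝒥, ∃ w, ρ i (x : H) = (oneAddInv D ^ κ) w) :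
    ∃ w, ρ j (x : H) = (oneAddInv D ^ (κ + δ)) w := by
  set G := oneAddInv D with hG
  have he : 0 ≤ e := hκ.trans hκe
  obtain ⟨F, hF, hFs, hFG, hFF⟩ := exists_boundedTransform_selfAdjoint hT.selfAdjoint
    hT.dense_domain
  obtain ⟨k, hk, hkc⟩ := hloc.exists_commutator_eq (star_mem hj)
  obtain ⟨w, hw⟩ := hreg (star k) (star_mem hk)
  set c := (G ^ (e - κ)) (ρ j (x' : H)) - adjoint X w with hc
  have hS1 : ∀ u, oneAddInvSqrt D u = (G ^ e) ((G ^ δ) u) := fun u => by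
    rw [oneAddInvSqrt, ← heδ, rpow_add_apply G he hδ]
  have hS2 : ∀ u, oneAddInvSqrt D u = (G ^ (e - κ)) ((G ^ (κ + δ)) u) := fun u => by
    rw [oneAddInvSqrt, ← rpow_add_apply G (by linarith) (by linarith), ← heδ,
      show e + δ = e - κ + (κ + δ) by ring]
  have hXT : ∀ u, (G ^ κ) (T ((G ^ δ) u)) = X ((G ^ (κ + δ)) u) := fun u => by
    rw [rpow_add_apply G hκ hδ]
    exact congrArg (fun B : H →L[ℂ] H => B ((G ^ δ) u)) hX
  -- F acts as DS, and Dρ(j*)Su = ρ(j*)Fu + TG^δ u. Pairing with x and using the adjoint relation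
  -- isolates ⟨ρ(j)x, Fu⟩.
  have key : ∀ u, inner ℂ (ρ j (x : H)) (F u) = inner ℂ c ((G ^ (κ + δ)) u) := by
    intro u
    have hFu := hF u
    have hD := hTb ((G ^ δ) u) (F u) (hS1 u ▸ hFu)
    rw [← hS1] at hD
    obtain ⟨p, q, hp, hpq⟩ := hloc.exists_localPreOp_graph
      (mem_idealSpan (ρ := ρ) (star_mem hj) (LinearPMap.mem_domain_of_mem_graph hFu))
    have hq : (q : H) = ρ (star j) (F u) + T ((G ^ δ) u) :=
      LinearPMap.mem_graph_snd_inj _ ((mem_graph_localPreOp hloc).1 hpq).2 hD hp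
    have hkT : ρ k (T ((G ^ δ) u)) = T ((G ^ δ) u) := by
      have h1 := hkc hFu hD
      rwa [add_sub_cancel_left] at h1
    have h1 : inner ℂ (x' : H) (ρ (star j) (oneAddInvSqrt D u)) = inner ℂ (x : H) (q : H) := by
      rw [← hp]
      exact inner_localOp_adjoint hT.dense_domain hloc hx (localPreOp_graph_le hpq)
    -- Locality inserts ρ(k) before T, so x may be replaced by ρ(k*)x = G^κ w; then G^κ is moved
    -- past T, leaving G^(κ+δ) on u.
    have h2 : inner ℂ (x : H) (T ((G ^ δ) u)) = inner ℂ (adjoint X w) ((G ^ (κ + δ)) u) := by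
      rw [← hkT, ← star_star k, ← inner_rep_left, hw,
        inner_left_of_isSelfAdjoint (isSelfAdjoint_rpow G κ), hXT,
        ContinuousLinearMap.adjoint_inner_left]
    rw [hq, inner_add_right] at h1
    rw [hc, inner_sub_left, inner_left_of_isSelfAdjoint (isSelfAdjoint_rpow G _), ← hS2,
      inner_rep_left, inner_rep_left, h1, h2, add_sub_cancel_right]
  have hFx : F (ρ j (x : H)) = (G ^ (κ + δ)) c := by
    refine ext_inner_right ℂ fun u => ?_
    rw [inner_left_of_isSelfAdjoint hFs, key,
      inner_left_of_isSelfAdjoint (isSelfAdjoint_rpow G _)]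
  have hcomm : ∀ v, F ((G ^ (κ + δ)) v) = (G ^ (κ + δ)) (F v) := fun v => by
    have h : Commute (G ^ (κ + δ)) F := by
      rw [CFC.rpow_def]
      exact hFG.cfc_nnreal _
    exact (congrArg (fun B : H →L[ℂ] H => B v) h).symm
  have hG1 : ∀ v, G v = (G ^ (κ + δ)) ((G ^ (1 - (κ + δ))) v) := fun v => by
    rw [← rpow_add_apply G (by linarith) (by linarith), add_sub_cancel,
      CFC.rpow_one G hT.oneAddInv_nonneg]
  -- ρ(j)x = (G + F²)ρ(j)x with Fρ(j)x = G^(κ+δ)c. Both terms lie in the range of G^(κ+δ), since F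
  -- commutes with powers of G.
  refine ⟨(G ^ (1 - (κ + δ))) (ρ j (x : H)) + F c, ?_⟩
  rw [map_add, ← hG1, ← hcomm, ← hFx]
  exact hFF _

/-- Iterates the regularity step from κ = 0 to κ = e; the last step reaches e + δ = 1/2, where the
range of G^(1/2) is dom D. -/
theorem map_adjoint_localOp_domain (hT : IsHigherOrderSpectralTriple ρ 𝒜 D m)
    (hJ : IsStarIdeal 𝒥 𝒜) (hloc : IsLocal ρ 𝒥 D) {x x' : localSpace ρ 𝒥}
    (hx : (x, x') ∈ (localOp ρ 𝒥 D).adjoint.graph) {j : A} (hj : j ∈ 𝒥) :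
    localRep ρ hT.dense_alg hJ j x ∈ (localOp ρ 𝒥 D).domain := by
  set G := oneAddInv D with hG
  have hG0 : 0 ≤ G := hT.oneAddInv_nonneg
  have hM : 1 ≤ max m 1 := le_max_right _ _
  have hbd := fun (a : A) (ha : a ∈ 𝒜) => hT.exists_commutatorBound ha
  set δ := 1 / (2 * max m 1) with hδ
  have hδ0 : 0 < δ := by positivity
  have he : 0 ≤ 1 / 2 - δ := sub_nonneg.2 (one_div_le_one_div_of_le two_pos (by linarith))
  set e := 1 / 2 - δ with hedef
  have heδ : e + δ = 1 / 2 := sub_add_cancel _ _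
  -- N makes the grid width r = e/2^N at most δ, so a gain of δ covers one grid step. The grid is
  -- dyadic because the interpolation of T is available only at such exponents.
  obtain ⟨N, hN⟩ := exists_pow_lt_of_lt_one hδ0 (by norm_num : (1 / 2 : ℝ) < 1)
  set r := e / 2 ^ N with hr
  have hr0 : 0 ≤ r := by positivity
  have hrδ : r ≤ δ := by
    refine le_trans ?_ hN.le
    rw [hr, one_div, inv_pow, div_eq_mul_inv]
    exact mul_le_of_le_one_left (by positivity) (by linarith)
  have hre : r * (2 ^ N : ℕ) = e := by
    rw [hr]; push_cast; exact div_mul_cancel₀ _ (by positivity)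
  have hstep : ∀ k ≤ 2 ^ N, (∀ i ∈ 𝒥, ∃ w, ρ i (x : H) = (G ^ (r * (k : ℕ))) w) →
      ∀ i ∈ 𝒥, ∃ w, ρ i (x : H) = (G ^ (r * (k : ℕ) + δ)) w := by
    intro k hk hreg i hi
    obtain ⟨T, hTb⟩ := hbd _ (hJ.le (star_mem hi))
    obtain ⟨T', hTb'⟩ := hbd _ (hJ.le hi)
    have h1 := hT.commutatorBound_adjoint he hδ0.le heδ hTb (by rwa [star_star])
    have h2 : (G ^ r) ^ (2 ^ N) * T = -adjoint T' * (G ^ r) ^ (2 ^ N) := by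
      rw [rpow_pow G hG0 hr0, hre, h1]
    obtain ⟨X, hX⟩ := exists_intertwine_of_pow (isSelfAdjoint_rpow G r)
      (injective_rpow hG0 hT.oneAddInv_injective hr0) N h2 k hk
    rw [rpow_pow G hG0 hr0] at hX
    have hke : r * (k : ℕ) ≤ e := by
      rw [← hre]
      gcongr
    exact adjoint_regularity_step hT hloc hx hδ0.le heδ (by positivity) hke hi hTb hX hreg
  have hall : ∀ k ≤ 2 ^ N, ∀ i ∈ 𝒥, ∃ w, ρ i (x : H) = (G ^ (r * (k : ℕ))) w := by
    intro k
    induction k with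
    | zero => exact fun _ i _ => ⟨ρ i (x : H), by simp [CFC.rpow_zero G hG0]⟩
    | succ k ih =>
      intro hk i hi
      obtain ⟨w, hw⟩ := hstep k (by omega) (ih (by omega)) i hi
      refine ⟨(G ^ (δ - r)) w, ?_⟩
      rw [← rpow_add_apply G (by positivity) (by linarith), hw]
      congr 2
      push_cast
      ring_nf
  obtain ⟨w, hw⟩ := hstep _ le_rfl (hall _ le_rfl) j hj
  rw [hre, heδ] at hw
  have hdom : ρ j (x : H) ∈ D.domain :=
    (range_oneAddInvSqrt hT.isClosed_op hT.dense_domain).2 ⟨w, hw⟩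
  -- Being in dom D is not yet being in dom D_𝒥; j = kj places ρ(j)x = ρ(k)ρ(j)x in 𝒥 dom D.
  obtain ⟨k, hk, hkj, -⟩ := hloc j hj
  have hkx : ρ j (x : H) = ρ k (ρ j (x : H)) := by rw [rep_rep, ← hkj]
  obtain ⟨p, q, hp, hpq⟩ := hloc.exists_localPreOp_graph (mem_idealSpan (ρ := ρ) hk hdom)
  have hpx : localRep ρ hT.dense_alg hJ j x = p := Subtype.ext (hkx.trans hp.symm)
  rw [hpx]
  exact LinearPMap.mem_domain_of_mem_graph (localPreOp_graph_le hpq)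

end LocalOperator

/-! ### Compactness and commutator conditions for D_𝒥 -/

section LocalTriple

open ContinuousLinearMap

variable {A : Type*} [NonUnitalCStarAlgebra A]
  {H : Type*} [NormedAddCommGroup H] [InnerProductSpace ℂ H] [CompleteSpace H]
  {ρ : A →⋆ₙₐ[ℂ] (H →L[ℂ] H)} {𝒜 𝒥 : NonUnitalStarSubalgebra ℂ A} {D : H →ₗ.[ℂ] H} {m : ℝ}

omit [CompleteSpace H] in
theorem isCompactOperator_of_coe {K : Submodule ℂ H} [CompleteSpace K] {B : K →L[ℂ] K}
    {B' : K →L[ℂ] H} (hB' : IsCompactOperator B') (h : ∀ x, B' x = (B x : H)) :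
    IsCompactOperator B := by
  have h1 : B = K.orthogonalProjectionOnto ∘L B' := by
    ext x
    change (B x : H) = K.orthogonalProjectionOnto (B' x)
    rw [h, Submodule.orthogonalProjectionOnto_mem_subspace_eq_self]
  rw [h1]
  exact hB'.clm_comp K.orthogonalProjectionOnto

theorem isCompactOperator_localRep (hT : IsHigherOrderSpectralTriple ρ 𝒜 D m)
    (hJ : IsStarIdeal 𝒥 𝒜) (hloc : IsLocal ρ 𝒥 D) {a : A}
    (ha : IsCompactOperator (ρ a ∘L oneAddInvSqrt D)) :
    IsCompactOperator (localRep ρ hT.dense_alg hJ a ∘L oneAddInvSqrt (localOp ρ 𝒥 D)) := by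
  obtain ⟨C, hC⟩ := exists_localOp_rpow_factor hT hloc (s := 1 / 2) (by norm_num) le_rfl
  exact isCompactOperator_of_coe (B' := (ρ a ∘L oneAddInvSqrt D) ∘L C) (ha.comp_clm C)
    fun x => congrArg (ρ a) (hC x).symm

/-- Compact operators are norm closed and 𝒜 is dense. This covers a unit of A that need not belong
to 𝒜. -/
theorem isCompactOperator_rep (hT : IsHigherOrderSpectralTriple ρ 𝒜 D m) (a : A) :
    IsCompactOperator (ρ a ∘L oneAddInvSqrt D) := by
  have hρ : Continuous ρ := AddMonoidHomClass.continuous_of_bound ρ 1 fun b => by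
    simpa using NonUnitalStarAlgHom.norm_apply_le ρ b
  have hc : Continuous fun a : A => ρ a ∘L oneAddInvSqrt D := by fun_prop
  have hcl : IsClosed {a : A | IsCompactOperator (ρ a ∘L oneAddInvSqrt D)} :=
    isClosed_setOfPred_isCompactOperator.preimage hc
  exact hcl.closure_subset_iff.2 (fun b hb => hT.compact_resolvent b hb) (hT.dense_alg a)

/-- ρ need not be nondegenerate, so the unit may fail to act as the identity on H, but it does so on
𝒥H. -/
theorem rep_eq_self_of_mem_localSpace {e : A} (he : ∀ a : A, e * a = a) {x : H}
    (hx : x ∈ localSpace ρ 𝒥) : ρ e x = x := by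
  have h : localSpace ρ 𝒥 ≤ LinearMap.eqLocus (ρ e : H →ₗ[ℂ] H) LinearMap.id := by
    refine Submodule.topologicalClosure_minimal _ (Submodule.span_le.2 ?_) ?_
    · rintro _ ⟨j, -, w, -, rfl⟩
      change ρ e (ρ j w) = ρ j w
      rw [rep_rep, he]
    · exact isClosed_eq (ρ e).continuous continuous_id
  exact h hx

/-- If `A` is unital, then `D_𝒥` has compact resolvent. -/
theorem isCompactOperator_oneAddInv_localOp (hT : IsHigherOrderSpectralTriple ρ 𝒜 D m)
    (hJ : IsStarIdeal 𝒥 𝒜) (hloc : IsLocal ρ 𝒥 D) {e : A} (he : ∀ a : A, e * a = a) :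
    IsCompactOperator (oneAddInv (localOp ρ 𝒥 D)) := by
  have h1 := isCompactOperator_localRep hT hJ hloc (isCompactOperator_rep hT e)
  have h3 := oneAddInvSqrt_mul_self (T := localOp ρ 𝒥 D)
    (isClosed_localOp hT.dense_domain hT.symmetric hloc)
    (dense_localOp_domain hT.dense_domain hloc)
  have h2 : oneAddInv (localOp ρ 𝒥 D) =
      (localRep ρ hT.dense_alg hJ e ∘L oneAddInvSqrt (localOp ρ 𝒥 D)) ∘L
        oneAddInvSqrt (localOp ρ 𝒥 D) := by
    ext x
    change _ = ρ e (oneAddInvSqrt (localOp ρ 𝒥 D) (oneAddInvSqrt (localOp ρ 𝒥 D) x) : H)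
    rw [rep_eq_self_of_mem_localSpace he (Subtype.prop _), h3]
  rw [h2]
  exact h1.comp_clm _

/-- Transfers a formula for [D,ρ(a)]G^s to D_𝒥 through G_𝒥^s = G^s C. It serves the bounded and the
compact commutator conditions alike. -/
theorem localOp_commutator_eq (hT : IsHigherOrderSpectralTriple ρ 𝒜 D m)
    (hJ : IsStarIdeal 𝒥 𝒜) (hloc : IsLocal ρ 𝒥 D) {a : A} {s : ℝ} {T : H →L[ℂ] H}
    (hTc : ∀ z y y', ((oneAddInv D ^ s) z, y) ∈ D.graph →
      (ρ a ((oneAddInv D ^ s) z), y') ∈ D.graph → T z = y' - ρ a y)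
    {C : localSpace ρ 𝒥 →L[ℂ] H}
    (hC : ∀ x, ((oneAddInv (localOp ρ 𝒥 D) ^ s) x : H) = (oneAddInv D ^ s) (C x))
    {x y y' : localSpace ρ 𝒥}
    (hy : ((oneAddInv (localOp ρ 𝒥 D) ^ s) x, y) ∈ (localOp ρ 𝒥 D).graph)
    (hy' : (localRep ρ hT.dense_alg hJ a ((oneAddInv (localOp ρ 𝒥 D) ^ s) x), y') ∈
      (localOp ρ 𝒥 D).graph) :
    ((localSpace ρ 𝒥).orthogonalProjectionOnto ∘L T ∘L C) x =
      y' - localRep ρ hT.dense_alg hJ a y := by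
  have h1 := localOp_graph_coe hT.dense_domain hT.symmetric hT.isClosed_op hloc hy
  have h2 : (ρ a ((oneAddInv (localOp ρ 𝒥 D) ^ s) x : H), (y' : H)) ∈ D.graph :=
    localOp_graph_coe hT.dense_domain hT.symmetric hT.isClosed_op hloc hy'
  rw [hC] at h1 h2
  have h3 : T (C x) = (y' - localRep ρ hT.dense_alg hJ a y : localSpace ρ 𝒥) := hTc _ _ _ h1 h2
  change (localSpace ρ 𝒥).orthogonalProjectionOnto (T (C x)) = _
  rw [h3, Submodule.orthogonalProjectionOnto_mem_subspace_eq_self]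

theorem IsCommutatorBound.apply_eq {B T : H →L[ℂ] H} {e : ℝ} (h : IsCommutatorBound D B e T)
    {z y y' : H} (hy : ((oneAddInv D ^ e) z, y) ∈ D.graph)
    (hy' : (B ((oneAddInv D ^ e) z), y') ∈ D.graph) : T z = y' - B y := by
  rw [LinearPMap.mem_graph_snd_inj _ hy' (h z y hy) rfl, add_sub_cancel_left]

theorem extendsToBounded_localOp_commutator (hT : IsHigherOrderSpectralTriple ρ 𝒜 D m)
    (hJ : IsStarIdeal 𝒥 𝒜) (hloc : IsLocal ρ 𝒥 D) {a : A} (ha : a ∈ 𝒜) :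
    ExtendsToBounded (pcomp (opCommutator (localOp ρ 𝒥 D) (localRep ρ hT.dense_alg hJ a))
      (oneAddPow (localOp ρ 𝒥 D) (-(1 / 2) + 1 / (2 * max m 1)))) := by
  obtain ⟨T, hTb⟩ := hT.exists_commutatorBound ha
  have hM : 1 ≤ max m 1 := le_max_right _ _
  have hδ0 : 0 < 1 / (2 * max m 1) := by positivity
  have hδ1 : 1 / (2 * max m 1) ≤ 1 / 2 := one_div_le_one_div_of_le two_pos (by linarith)
  obtain ⟨C, hC⟩ := exists_localOp_rpow_factor hT hloc (s := 1 / 2 - 1 / (2 * max m 1))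
    (by linarith) (by linarith)
  refine ⟨(localSpace ρ 𝒥).orthogonalProjectionOnto ∘L T ∘L C, le_bdd_iff.2 fun x z hz => ?_⟩
  obtain ⟨u, hu, hz⟩ := mem_graph_pcomp.1 hz
  rw [oneAddPow, if_pos (by linarith), mem_graph_bdd, neg_add, neg_neg, ← sub_eq_add_neg] at hu
  subst hu
  obtain ⟨y, y', hy, hy', rfl⟩ := mem_graph_opCommutator.1 hz
  exact localOp_commutator_eq hT hJ hloc (fun _ _ _ h h' => hTb.apply_eq h h') hC hy hy'

theorem isCompactPMap_localOp_commutator (hT : IsHigherOrderSpectralTriple ρ 𝒜 D m)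
    (hA : (∃ e : A, ∀ a : A, e * a = a ∧ a * e = a) ∨
      ∀ a ∈ 𝒜, IsCompactPMap (pcomp (opCommutator D (ρ a)) (bdd (oneAddInvSqrt D))))
    (hJ : IsStarIdeal 𝒥 𝒜) (hloc : IsLocal ρ 𝒥 D) {a : A} (ha : a ∈ 𝒜) :
    IsCompactPMap (pcomp (opCommutator (localOp ρ 𝒥 D) (localRep ρ hT.dense_alg hJ a))
      (bdd (oneAddInvSqrt (localOp ρ 𝒥 D)))) := by
  have hd := dense_localOp_domain hT.dense_domain hloc
  have hcl := isClosed_localOp hT.dense_domain hT.symmetric hloc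
  -- Everywhere-definedness is automatic: ran G_𝒥^(1/2) = dom D_𝒥, which ρ(a) preserves. Only a
  -- compact operator with the right values is needed.
  suffices h : ∃ B : localSpace ρ 𝒥 →L[ℂ] localSpace ρ 𝒥, IsCompactOperator B ∧
      ∀ x y y', (oneAddInvSqrt (localOp ρ 𝒥 D) x, y) ∈ (localOp ρ 𝒥 D).graph →
        (localRep ρ hT.dense_alg hJ a (oneAddInvSqrt (localOp ρ 𝒥 D) x), y') ∈
          (localOp ρ 𝒥 D).graph → B x = y' - localRep ρ hT.dense_alg hJ a y by
    obtain ⟨B, hB, h⟩ := h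
    obtain ⟨F, hF, -⟩ := exists_boundedTransform hcl hd
    refine ⟨B, hB, eq_bdd_iff.2 fun x => ?_⟩
    obtain ⟨z, hz⟩ := localOp_map_graph hT hJ hloc ha (hF x)
    exact mem_graph_pcomp.2 ⟨_, mem_graph_bdd.2 rfl,
      mem_graph_opCommutator.2 ⟨_, _, hF x, hz, h _ _ _ (hF x) hz⟩⟩
  rcases hA with ⟨e, he⟩ | hA
  · have hGc := isCompactOperator_oneAddInv_localOp hT hJ hloc fun a => (he a).1
    obtain ⟨T, hTb⟩ := hT.exists_commutatorBound ha
    have hM : 1 ≤ max m 1 := le_max_right _ _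
    have hδ0 : 0 < 1 / (2 * max m 1) := by positivity
    have hδ1 : 1 / (2 * max m 1) ≤ 1 / 2 := one_div_le_one_div_of_le two_pos (by linarith)
    set δ := 1 / (2 * max m 1) with hδ
    obtain ⟨C, hC⟩ := exists_localOp_rpow_factor hT hloc (s := 1 / 2 - δ)
      (by linarith) (by linarith)
    -- G_𝒥^(1/2) = G_𝒥^e G_𝒥^δ: the first factor absorbs the commutator, and the second is compact
    -- because δ > 0.
    refine ⟨((localSpace ρ 𝒥).orthogonalProjectionOnto ∘L T ∘L C) ∘L
      (oneAddInv (localOp ρ 𝒥 D) ^ δ), ?_, fun x y y' hy hy' => ?_⟩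
    · have hGδ := isCompactOperator_rpow (oneAddInv_nonneg hcl hd) hGc hδ0
      exact hGδ.clm_comp ((localSpace ρ 𝒥).orthogonalProjectionOnto ∘L T ∘L C)
    · have hS : oneAddInvSqrt (localOp ρ 𝒥 D) x = (oneAddInv (localOp ρ 𝒥 D) ^ (1 / 2 - δ))
          ((oneAddInv (localOp ρ 𝒥 D) ^ δ) x) := by
        rw [← rpow_add_apply _ (by linarith) hδ0.le, sub_add_cancel, oneAddInvSqrt]
      rw [hS] at hy hy'
      exact localOp_commutator_eq hT hJ hloc (fun _ _ _ h h' => hTb.apply_eq h h') hC hy hy'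
  · obtain ⟨B, hB, hBe⟩ := hA a ha
    obtain ⟨C, hC⟩ := exists_localOp_rpow_factor hT hloc (s := 1 / 2) (by norm_num) le_rfl
    refine ⟨(localSpace ρ 𝒥).orthogonalProjectionOnto ∘L B ∘L C,
      (hB.comp_clm C).clm_comp (localSpace ρ 𝒥).orthogonalProjectionOnto, fun x y y' hy hy' => ?_⟩
    refine localOp_commutator_eq hT hJ hloc (fun z u u' h h' => ?_) hC hy hy'
    have h1 : (z, u' - ρ a u) ∈ (pcomp (opCommutator D (ρ a)) (bdd (oneAddInvSqrt D))).graph :=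
      mem_graph_pcomp.2 ⟨_, mem_graph_bdd.2 rfl, mem_graph_opCommutator.2 ⟨_, _, h, h', rfl⟩⟩
    rw [hBe] at h1
    exact mem_graph_bdd.1 h1

theorem IsStarIdeal.mul_mem_topologicalClosure (hd : Dense (𝒜 : Set A)) (hJ : IsStarIdeal 𝒥 𝒜)
    (a : A) {j : A} (hj : j ∈ 𝒥.topologicalClosure) :
    a * j ∈ 𝒥.topologicalClosure ∧ j * a ∈ 𝒥.topologicalClosure := by
  have hj' : j ∈ closure (𝒥 : Set A) := hj
  have ha := hd a
  exact ⟨map_mem_closure₂ continuous_mul ha hj' fun b hb i hi => hJ.mul_left b hb i hi,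
    map_mem_closure₂ continuous_mul hj' ha fun i hi b hb => hJ.mul_right b hb i hi⟩

end LocalTriple

end RelSpectral

/-! ### The theorem -/

open RelSpectral

theorem theorem2p9 {A : Type*} [NonUnitalCStarAlgebra A]
    {H : Type*} [NormedAddCommGroup H] [InnerProductSpace ℂ H] [CompleteSpace H]
    (ρ : A →⋆ₙₐ[ℂ] (H →L[ℂ] H)) (𝒜 𝒥 : NonUnitalStarSubalgebra ℂ A) (D : H →ₗ.[ℂ] H) (m : ℝ)
    (hT : IsHigherOrderSpectralTriple ρ 𝒜 D m)
    (hA : (∃ e : A, ∀ a : A, e * a = a ∧ a * e = a) ∨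
      ∀ a ∈ 𝒜, IsCompactPMap (pcomp (opCommutator D (ρ a)) (bdd (oneAddInvSqrt D))))
    (hJ : IsStarIdeal 𝒥 𝒜) (hloc : IsLocal ρ 𝒥 D) :
    IsHigherOrderRelativeSpectralTriple (localRep ρ hT.dense_alg hJ) 𝒜 𝒥.topologicalClosure 𝒥
        (localOp ρ 𝒥 D) (max m 1) ∧
      (∀ (γ : H →L[ℂ] H) (hγ : IsGrading γ ρ D),
        IsGrading (localGrading 𝒥 hγ) (localRep ρ hT.dense_alg hJ) (localOp ρ 𝒥 D)) ∧
      ∀ a ∈ 𝒜, IsCompactOperator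
        (localRep ρ hT.dense_alg hJ a ∘L oneAddInvSqrt (localOp ρ 𝒥 D)) := by
  have hs := hT.symmetric
  have hd := hT.dense_domain
  have hcomp : ∀ a ∈ 𝒜, IsCompactOperator
      (localRep ρ hT.dense_alg hJ a ∘L oneAddInvSqrt (localOp ρ 𝒥 D)) := fun a ha =>
    isCompactOperator_localRep hT hJ hloc (hT.compact_resolvent a ha)
  refine ⟨?_, fun γ hγ => localGrading_isGrading hd hs hloc hT.dense_alg hJ hγ, hcomp⟩
  exact
    { order_pos := lt_max_of_lt_right one_pos
      separable := by
        have := hT.separable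
        have := UniformSpace.secondCountable_of_separable H
        infer_instance
      dense_alg := hT.dense_alg
      isClosed_ideal := 𝒥.isClosed_topologicalClosure
      ideal := fun a j hj => hJ.mul_mem_topologicalClosure hT.dense_alg a hj
      sub_alg := hJ.le
      sub_ideal := 𝒥.le_topologicalClosure
      dense_ideal := fun j hj => hj
      dense_domain := dense_localOp_domain hd hloc
      isClosed_op := isClosed_localOp hd hs hloc
      symmetric := symmetric_localOp hd hs hT.isClosed_op hloc
      map_domain := fun a ha x hx => by
        obtain ⟨z, hz⟩ := localOp_map_graph hT hJ hloc ha (LinearPMap.mem_graph _ ⟨x, hx⟩)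
        exact LinearPMap.mem_domain_of_mem_graph hz
      map_adjoint_domain := fun j hj x hx =>
        map_adjoint_localOp_domain hT hJ hloc (LinearPMap.mem_graph _ ⟨x, hx⟩) hj
      compact_resolvent := fun j hj => hcomp j (hJ.le hj)
      compact_commutator := fun a ha => isCompactPMap_localOp_commutator hT hA hJ hloc ha
      bounded_commutator := by
        intro a ha
        exact extendsToBounded_localOp_commutator hT hJ hloc ha }
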